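/- Let $d\ge 2$. For a finite measure $\mu$ on $]0,+\infty[$, let $\Sigma(\mu)=\bigcup_{(c,r)\in\xi}B(c,r)$ be the Boolean model driven by $\mu$, where $\xi$ is a Poisson point process on $\mathbb{R}^d\times]0,+\infty[$ whose intensity is the product of the Lebesgue measure by $\mu$, and $B(c,r)$ is the open Euclidean ball of radius $r$ centered at $c$. Let $S(r)$ be the Euclidean sphere of radius $r$ centered at the origin, and set $$\widehat{\lambda}_c(\mu)=\sup\Big\{\lambda>0 : P\big(\text{there is a path in }\Sigma(\lambda\mu)\text{ from }S(r/2)\text{ to }S(r)\big)\to 0\text{ as }r\to\infty\Big\}$$ (with $\sup\emptyset=0$). For $\rho>1$ let $H_\rho\mu$ be the measure $H_\rho\mu(A)=\rho^d\mu(\rho A)$, which drives the scaled Boolean model $\rho^{-1}\Sigma(\mu)$. Let $\nu_1$ and $\nu_2$ be two finite measures on $]0,+\infty[$ with positive mass. Then $\widehat{\lambda}_c(\nu_1)$ and $\widehat{\lambda}_c(\nu_2)$ are finite and, for all $0<\alpha<1$ and all $\rho>1$, $$\widehat{\lambda}_c(\alpha\nu_1+(1-\alpha)H_\rho\nu_2)\le\min\big(\widehat{\lambda}_c(\alpha\nu_1),\widehat{\lambda}_c((1-\alpha)H_\rho\nu_2)\big)=\min\left(\frac{\widehat{\lambda}_c(\nu_1)}{\alpha},\frac{\widehat{\lambda}_c(\nu_2)}{1-\alpha}\right).$$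 Moreover, $$\widehat{\lambda}_c(\alpha\nu_1+(1-\alpha)H_\rho\nu_2)\to\min\left(\frac{\widehat{\lambda}_c(\nu_1)}{\alpha},\frac{\widehat{\lambda}_c(\nu_2)}{1-\alpha}\right)\quad\text{as }\rho\to\infty,$$ uniformly in $\alpha\in\,]0,1[$. -/

import Mathlib

open MeasureTheory ProbabilityTheory Filter Topology Set
open scoped NNReal ENNReal

/-- `ξ` is a Poisson point process with intensity `Lam`, defined on the probability space `(Ω, P)`
and viewed as a random counting measure: every realization is a countable sum of Dirac masses, the
number of points in a measurable set `A` of finite intensity is Poisson with parameter `Lam A`, and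
the numbers of points in pairwise disjoint measurable sets are independent. -/
structure IsPoissonProcess {X Ω : Type*} [MeasurableSpace X] [MeasurableSpace Ω]
    (P : Measure Ω) (ξ : Ω → Measure X) (Lam : Measure X) : Prop where
  measurable : Measurable ξ
  isPoint : ∀ ω, ∃ (I : Set ℕ) (x : I → X), ξ ω = Measure.sum fun i : I => Measure.dirac (x i)
  count_law : ∀ A : Set X, MeasurableSet A → Lam A ≠ ∞ →
    P.map (fun ω => ξ ω A) =
      (poissonMeasure (Lam A).toNNReal).map (fun n : ℕ => (n : ℝ≥0∞))
  indep : ∀ (n : ℕ) (A : Fin n → Set X), (∀ i, MeasurableSet (A i)) →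
    Pairwise (fun i j => Disjoint (A i) (A j)) → iIndepFun (fun i ω => ξ ω (A i)) P

/-- The union of the open Euclidean balls `B(c, r)` over the points `(c, r)` of a counting
measure `m` on `ℝ^d × ℝ`. -/
def ballUnion {d : ℕ} (m : Measure (EuclideanSpace ℝ (Fin d) × ℝ)) :
    Set (EuclideanSpace ℝ (Fin d)) :=
  ⋃ z ∈ {z : EuclideanSpace ℝ (Fin d) × ℝ | m {z} ≠ 0}, Metric.ball z.1 z.2

/-- There is a continuous path, contained in `S`, from a point of `A` to a point of `B`. -/
def PathConnects {E : Type*} [TopologicalSpace E] (A B S : Set E) : Prop :=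
  ∃ x ∈ A, ∃ y ∈ B, JoinedIn S x y

/-- The probability that the Boolean model with parameter `μ` contains a path from the sphere of
radius `r / 2` to the sphere of radius `r` (both centered at the origin) tends to `0` as `r → ∞`.
The Boolean model is the union of the balls of a Poisson point process with intensity
`Lebesgue ⊗ μ`; the law of such a process is determined by its intensity, so that the choice of the
process is immaterial. -/
def CrossingVanishes (d : ℕ) (μ : Measure ℝ) : Prop :=
  ∀ (Ω : Type) [MeasurableSpace Ω] (P : Measure Ω) [IsProbabilityMeasure P]
    (ξ : Ω → Measure (EuclideanSpace ℝ (Fin d) × ℝ)),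
    IsPoissonProcess P ξ ((volume : Measure (EuclideanSpace ℝ (Fin d))).prod μ) →
    Tendsto (fun r : ℝ =>
        P {ω | PathConnects (Metric.sphere 0 (r / 2)) (Metric.sphere 0 r) (ballUnion (ξ ω))})
      atTop (𝓝 0)

/-- The critical parameter `λ̂_c(μ)`, a supremum in `[0, ∞]` (equal to `0` for the empty set). -/
noncomputable def lambdaHat (d : ℕ) (μ : Measure ℝ) : ℝ≥0∞ :=
  sSup ((fun l : ℝ≥0 => (l : ℝ≥0∞)) '' {l : ℝ≥0 | 0 < l ∧ CrossingVanishes d (l • μ)})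

/-- The measure `A ↦ ρ^d μ(ρ A)`; it drives the Boolean model of `μ` scaled by `ρ⁻¹`. -/
noncomputable def scaleMeasure (d : ℕ) (ρ : ℝ) (μ : Measure ℝ) : Measure ℝ :=
  (ENNReal.ofReal ρ) ^ d • μ.map (fun r => r / ρ)

/-- The measure `α ν₁ + (1 - α) H_ρ ν₂`. -/
noncomputable def mixMeasure (d : ℕ) (α ρ : ℝ) (ν₁ ν₂ : Measure ℝ) : Measure ℝ :=
  ENNReal.ofReal α • ν₁ + ENNReal.ofReal (1 - α) • scaleMeasure d ρ ν₂

/-! ### Construction of Poisson point processes -/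

section PoissonExistence

/-! The upper bound is superposition: adding an independent Boolean model can only create crossings.
The formula for the minimum holds because `H_ρ` merely shrinks the model, so its crossing
probability at scale `r` is the old one at scale `ρ r`, and because multiplying a measure by `a`
divides its threshold by `a`. Finiteness comes from a hierarchical block argument on a planar grid:
at high intensity, blocks of side `3 ^ n` are bad with doubly exponentially small probability, and
good blocks carry long paths (`lambdaHat_ne_top`).

The convergence rests on two facts. One is a finite-size criterion (`exists_finite_size_criterion`):
a crossing at scale `10 R` forces two distant, hence independent, crossings at scale `R`, unless a
large ball is present. This gives a recursion `π(10 R) ≤ K π(R) ^ 2 + C * tail(R)`, so smallness at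
one scale, together with a small and vanishing tail of the moment of order `d`, implies
subcriticality. The required finite moment is itself forced by subcriticality.

The other is separation of scales (`crossingVanishes_add_scaleMeasure`). For large `ρ` the shrunken
subcritical model has only components of diameter less than `δ` near `B(0, R)`. A path in the union
of the two models then stays within `δ` of the first one, hence inside the first model with radii
multiplied by `1 + s`, once its very small balls are discarded as improbable. Up to scaling, this
enlargement only multiplies the intensity by `(1 + s) ^ d`, which keeps the model subcritical for
small `s`. Thus crossings of the mixture are rare at a fixed scale `R`, and the criterion applies.

Uniformity in `α` is obtained by monotonicity from a single pair of subcritical intensities,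
slightly below the two thresholds, which dominates all mixtures simultaneously.

Probabilities are computed through void events `{m | m K = 0}`: they generate a σ-algebra containing
the crossing events, and their probabilities determine the law there. -/

theorem exists_probability_smul {X : Type*} [MeasurableSpace X] [Nonempty X] (Λ : Measure X)
    [IsFiniteMeasure Λ] : ∃ q : Measure X, IsProbabilityMeasure q ∧ Λ = Λ univ • q := by
  by_cases h : Λ = 0
  · exact ⟨Measure.dirac (Classical.arbitrary X), inferInstance, by simp [h]⟩
  · have h0 : Λ univ ≠ 0 := by simpa using h
    refine ⟨(Λ univ)⁻¹ • Λ, ⟨?_⟩, ?_⟩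
    · simp [ENNReal.inv_mul_cancel h0 (measure_ne_top _ _)]
    · rw [smul_smul, ENNReal.mul_inv_cancel h0 (measure_ne_top _ _), one_smul]

theorem integral_prod_range_infinitePi {Ω : ℕ → Type*} [∀ n, MeasurableSpace (Ω n)]
    (P : ∀ n, Measure (Ω n)) [∀ n, IsProbabilityMeasure (P n)] (f : ∀ n, Ω n → ℂ)
    (hf : ∀ n, Measurable (f n)) (M : ℕ) :
    ∫ ω, ∏ n ∈ Finset.range M, f n (ω n) ∂(Measure.infinitePi P) =
      ∏ n ∈ Finset.range M, ∫ x, f n x ∂(P n) := by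
  have hi : iIndepFun (fun n (ω : ∀ n, Ω n) => f n (ω n)) (Measure.infinitePi P) :=
    iIndepFun_infinitePi hf
  have hi' : iIndepFun (fun (n : Finset.range M) (ω : ∀ n, Ω n) => f n (ω n))
      (Measure.infinitePi P) := hi.precomp Subtype.val_injective
  have h := hi'.integral_fun_prod_eq_prod_integral (fun n =>
    ((hf n).comp (measurable_pi_apply (n : ℕ))).aestronglyMeasurable)
  rw [← Finset.prod_coe_sort (Finset.range M) (fun n => ∫ x, f n x ∂(P n))]
  calc _ = ∫ ω, ∏ n : Finset.range M, f n (ω n) ∂(Measure.infinitePi P) := by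
        congr 1; ext ω
        rw [← Finset.prod_coe_sort (Finset.range M) (fun n => f n (ω n))]
    _ = _ := h
    _ = _ := by
        refine Finset.prod_congr rfl fun n _ => ?_
        have := (measurePreserving_eval_infinitePi P (n : ℕ))
        rw [← this.map_eq, integral_map (measurable_pi_apply _).aemeasurable
          (by rw [this.map_eq]; exact (hf n).aestronglyMeasurable)]

theorem measurable_prod_range_fst {X : Type*} [MeasurableSpace X] (g : X → ℂ)
    (hg : Measurable g) :
    Measurable fun ω : ℕ × (ℕ → X) => ∏ k ∈ Finset.range ω.1, g (ω.2 k) := by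
  refine measurable_from_prod_countable_right fun N => ?_
  exact Finset.measurable_prod (f := fun k (y : ℕ → X) => g (y k)) (Finset.range N)
    fun k _ => hg.comp (measurable_pi_apply k)

/-- Conditionally on the number `N` of points, the integral is the `N`-th power of `∫ g`; summing
over the Poisson law of `N` gives an exponential series. -/
theorem integral_prod_poisson {X : Type*} [MeasurableSpace X] (r : ℝ≥0) (q : Measure X)
    [IsProbabilityMeasure q] (g : X → ℂ) (hg : Measurable g) (hb : ∀ x, ‖g x‖ ≤ 1) :
    ∫ ω, ∏ k ∈ Finset.range ω.1, g (ω.2 k)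
        ∂((poissonMeasure r).prod (Measure.infinitePi fun _ : ℕ => q)) =
      Complex.exp (r * (∫ x, g x ∂q - 1)) := by
  rw [integral_prod]
  swap
  · refine Integrable.of_bound (measurable_prod_range_fst g hg).aestronglyMeasurable 1
      (Eventually.of_forall fun ω => ?_)
    rw [norm_prod]
    exact Finset.prod_le_one (fun _ _ => norm_nonneg _) fun _ _ => hb _
  have : ∀ N : ℕ, ∫ x : ℕ → X, ∏ k ∈ Finset.range N, g (x k)
      ∂(Measure.infinitePi fun _ : ℕ => q) = (∫ x, g x ∂q) ^ N := by
    intro N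
    rw [integral_prod_range_infinitePi (fun _ => q) (fun _ => g) (fun _ => hg)]
    simp
  simp only [this]
  rw [integral_poissonMeasure]
  set a := ∫ x, g x ∂q
  calc ∑' n : ℕ, (Real.exp (-r) * r ^ n / n.factorial : ℝ) • a ^ n
    _ = ∑' n : ℕ, (Real.exp (-r) : ℂ) * ((r * a) ^ n / n.factorial) := by
      congr with n
      rw [Complex.real_smul]
      push_cast
      rw [mul_pow]
      ring
    _ = (Real.exp (-r) : ℂ) * ∑' n : ℕ, ((r * a) ^ n / n.factorial) := tsum_mul_left
    _ = (Real.exp (-r) : ℂ) * Complex.exp (r * a) := by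
      rw [(NormedSpace.expSeries_div_hasSum_exp (r * a)).tsum_eq, Complex.exp_eq_exp_ℂ]
    _ = _ := by
      rw [Complex.ofReal_exp, ← Complex.exp_add]
      push_cast
      ring_nf

/-- The number of points in `A` among the first `ω.1` points of the sequence `ω.2`. -/
noncomputable def blockCount {X : Type*} (A : Set X) (ω : ℕ × (ℕ → X)) : ℝ :=
  ∑ k ∈ Finset.range ω.1, A.indicator 1 (ω.2 k)

/-- The number of points in `A` in the first `M` blocks. -/
noncomputable def partialCount {X : Type*} (M : ℕ) (A : Set X) (ω : ℕ → ℕ × (ℕ → X)) : ℝ :=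
  ∑ n ∈ Finset.range M, blockCount A (ω n)

theorem measurable_blockCount {X : Type*} [MeasurableSpace X] {A : Set X} (hA : MeasurableSet A) : Measurable (blockCount A) := by
  refine measurable_from_prod_countable_right fun N => ?_
  have h1 : Measurable (A.indicator (1 : X → ℝ)) := measurable_one.indicator hA
  exact Finset.measurable_sum (f := fun k (y : ℕ → X) => A.indicator (1 : X → ℝ) (y k))
    (Finset.range N) fun k _ => h1.comp (measurable_pi_apply k)

theorem measurable_partialCount {X : Type*} [MeasurableSpace X] (M : ℕ) {A : Set X} (hA : MeasurableSet A) :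
    Measurable (partialCount M A) :=
  Finset.measurable_sum _ fun n _ => (measurable_blockCount hA).comp (measurable_pi_apply n)

theorem blockCount_nonneg {X : Type*} (A : Set X) (ω : ℕ × (ℕ → X)) : 0 ≤ blockCount A ω :=
  Finset.sum_nonneg fun _ _ => indicator_nonneg (fun _ _ => zero_le_one) _

theorem integral_exp_partialCount {X : Type*} [MeasurableSpace X] (Λ q : ℕ → Measure X) [∀ n, IsFiniteMeasure (Λ n)]
    [∀ n, IsProbabilityMeasure (q n)] (hq : ∀ n, Λ n = Λ n univ • q n)
    {ι : Type*} [Fintype ι] (A : ι → Set X) (hA : ∀ i, MeasurableSet (A i))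
    (hd : Pairwise fun i j => Disjoint (A i) (A j)) (t : ι → ℝ) (M : ℕ) :
    ∫ ω, Complex.exp ((∑ i, partialCount M (A i) ω * t i : ℝ) * Complex.I)
      ∂(Measure.infinitePi fun n => (poissonMeasure (Λ n univ).toNNReal).prod
        (Measure.infinitePi fun _ : ℕ => q n)) =
    ∏ i, Complex.exp ((∑ n ∈ Finset.range M, (Λ n).real (A i) : ℝ) *
      (Complex.exp (t i * Complex.I) - 1)) := by
  classical
  set g : X → ℂ := fun x => Complex.exp ((∑ i, (A i).indicator 1 x * t i : ℝ) * Complex.I) with hg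
  have gm : Measurable g := by
    refine Complex.measurable_exp.comp ?_
    refine Measurable.mul_const (Complex.measurable_ofReal.comp ?_) _
    exact Finset.measurable_sum _ fun i _ => (measurable_one.indicator (hA i)).mul_const _
  have gb : ∀ x, ‖g x‖ ≤ 1 := fun x => (Complex.norm_exp_ofReal_mul_I _).le
  have e1 : ∀ ω : ℕ → ℕ × (ℕ → X),
      Complex.exp ((∑ i, partialCount M (A i) ω * t i : ℝ) * Complex.I) =
      ∏ n ∈ Finset.range M, ∏ k ∈ Finset.range (ω n).1, g ((ω n).2 k) := by
    intro ω
    simp only [hg]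
    simp_rw [← Complex.exp_sum, ← Finset.sum_mul, ← Complex.ofReal_sum]
    congr 3
    simp only [partialCount, blockCount, Finset.sum_mul]
    rw [Finset.sum_comm]
    refine Finset.sum_congr rfl fun n _ => ?_
    rw [Finset.sum_comm]
  simp_rw [e1]
  rw [integral_prod_range_infinitePi _
    (fun _ (ω : ℕ × (ℕ → X)) => ∏ k ∈ Finset.range ω.1, g (ω.2 k))
    (fun _ => measurable_prod_range_fst g gm)]
  simp_rw [integral_prod_poisson _ _ g gm gb]
  -- Disjointness enters here: each `x` lies in at most one `A i`, so `g - 1` is linear in the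
  -- indicators. The exponent then splits over `i`, which yields Poisson laws and independence at
  -- once.
  have g1 : ∀ x, g x - 1 = ∑ i, (A i).indicator
      (fun _ => Complex.exp (t i * Complex.I) - 1) x := by
    intro x
    by_cases hx : ∃ j, x ∈ A j
    · obtain ⟨j, hj⟩ := hx
      have hn : ∀ i, i ≠ j → x ∉ A i := fun i hij hi =>
        (Set.disjoint_left.mp (hd hij) hi) hj
      rw [Finset.sum_eq_single j (fun i _ hij => by simp [hn i hij]) (by simp)]
      simp only [hg]
      rw [Finset.sum_eq_single j (fun i _ hij => by simp [hn i hij]) (by simp)]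
      simp [hj]
    · push Not at hx
      simp [hg, hx]
  have e2 : ∀ n, ((Λ n univ).toNNReal : ℂ) * (∫ x, g x ∂(q n) - 1) =
      ∑ i, ((Λ n).real (A i) : ℂ) * (Complex.exp (t i * Complex.I) - 1) := by
    intro n
    have hint : Integrable g (q n) := Integrable.of_bound gm.aestronglyMeasurable 1
      (Eventually.of_forall gb)
    have : ∫ x, g x ∂(q n) - 1 = ∫ x, (g x - 1) ∂(q n) := by
      rw [integral_sub hint (integrable_const _)]; simp
    rw [this]
    simp_rw [g1]
    rw [integral_finsetSum _ fun i _ => (integrable_const _).indicator (hA i), Finset.mul_sum]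
    refine Finset.sum_congr rfl fun i _ => ?_
    rw [integral_indicator (hA i), integral_const, Complex.real_smul,
      measureReal_restrict_apply MeasurableSet.univ, univ_inter]
    rw [← mul_assoc]
    congr 1
    have : (Λ n).real (A i) = (Λ n univ).toNNReal * (q n).real (A i) := by
      conv_lhs => rw [hq n]
      rw [measureReal_ennreal_smul_apply]; rfl
    rw [this]; push_cast; rfl
  simp_rw [e2, ← Complex.exp_sum]
  congr 1
  rw [Finset.sum_comm]
  refine Finset.sum_congr rfl fun i _ => ?_
  rw [← Finset.sum_mul]
  push_cast
  rfl

/-- Countably many independent blocks, each made of a Poisson number of independent points. -/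
noncomputable def blockMeasure {X : Type*} [MeasurableSpace X] (Λ q : ℕ → Measure X) :
    Measure (ℕ → ℕ × (ℕ → X)) :=
  Measure.infinitePi fun n => (poissonMeasure (Λ n univ).toNNReal).prod
    (Measure.infinitePi fun _ : ℕ => q n)

/-- The superposition of the points of all blocks. -/
noncomputable def blockPoints {X : Type*} [MeasurableSpace X] (ω : ℕ → ℕ × (ℕ → X)) : Measure X :=
  Measure.sum fun n => ∑ k ∈ Finset.range (ω n).1, Measure.dirac ((ω n).2 k)

section

variable {X : Type*} [MeasurableSpace X] (Λ q : ℕ → Measure X) [∀ n, IsFiniteMeasure (Λ n)]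
  [∀ n, IsProbabilityMeasure (q n)]

instance : IsProbabilityMeasure (blockMeasure Λ q) := by
  unfold blockMeasure; infer_instance

theorem charFun_partialCount (hq : ∀ n, Λ n = Λ n univ • q n) {A : Set X}
    (hA : MeasurableSet A) (M : ℕ) (t : ℝ) :
    charFun ((blockMeasure Λ q).map (partialCount M A)) t =
      Complex.exp ((∑ n ∈ Finset.range M, (Λ n).real A : ℝ) *
      (Complex.exp (t * Complex.I) - 1)) := by
  have := integral_exp_partialCount Λ q hq (fun _ : Unit => A) (fun _ => hA)
    (fun i j h => absurd (Subsingleton.elim i j) h) (fun _ => t) M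
  rw [charFun_apply, integral_map (measurable_partialCount M hA).aemeasurable (by fun_prop)]
  simpa [blockMeasure, mul_comm] using this

theorem map_partialCount (hq : ∀ n, Λ n = Λ n univ • q n) {A : Set X}
    (hA : MeasurableSet A) (M : ℕ) :
    (blockMeasure Λ q).map (partialCount M A) =
      (poissonMeasure (∑ n ∈ Finset.range M, (Λ n A).toNNReal)).map (fun n : ℕ => (n : ℝ)) := by
  have : IsProbabilityMeasure ((blockMeasure Λ q).map (partialCount M A)) :=
    Measure.isProbabilityMeasure_map (measurable_partialCount M hA).aemeasurable
  refine Measure.ext_of_charFun ?_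
  ext t
  rw [charFun_partialCount Λ q hq hA, charFun_map_cast_poissonMeasure]
  congr 2
  push_cast
  rfl

theorem iIndepFun_partialCount (hq : ∀ n, Λ n = Λ n univ • q n) {m : ℕ} (A : Fin m → Set X)
    (hA : ∀ i, MeasurableSet (A i)) (hd : Pairwise fun i j => Disjoint (A i) (A j)) (M : ℕ) :
    iIndepFun (fun i => partialCount M (A i)) (blockMeasure Λ q) := by
  rw [iIndepFun_iff_charFun_pi fun i => (measurable_partialCount M (hA i)).aemeasurable]
  intro t
  simp_rw [charFun_partialCount Λ q hq (hA _)]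
  have h1 : Measurable fun ω : ℕ → ℕ × (ℕ → X) =>
      WithLp.toLp 2 (fun i => partialCount M (A i) ω) :=
    (by fun_prop : Measurable (WithLp.toLp 2 : (Fin m → ℝ) → _)).comp
      (measurable_pi_lambda _ fun i => measurable_partialCount M (hA i))
  rw [charFun_apply, integral_map h1.aemeasurable (by fun_prop)]
  rw [← integral_exp_partialCount Λ q hq A hA hd (fun i => t i) M]
  refine integral_congr_ae (Eventually.of_forall fun ω => ?_)
  simp [PiLp.inner_apply, mul_comm]

end

section

variable {X : Type*} [MeasurableSpace X]

theorem blockPoints_apply {A : Set X} (hA : MeasurableSet A) (ω : ℕ → ℕ × (ℕ → X)) :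
    blockPoints ω A = ∑' n, ENNReal.ofReal (blockCount A (ω n)) := by
  rw [blockPoints, Measure.sum_apply _ hA]
  congr 1; ext n
  rw [Measure.finsetSum_apply, blockCount, ENNReal.ofReal_sum_of_nonneg]
  · refine Finset.sum_congr rfl fun k _ => ?_
    rw [Measure.dirac_apply' _ hA]
    by_cases h : (ω n).2 k ∈ A <;> simp [h]
  · exact fun _ _ => indicator_nonneg (fun _ _ => zero_le_one) _

theorem ofReal_partialCount {X : Type*} (M : ℕ) (A : Set X) (ω : ℕ → ℕ × (ℕ → X)) :
    ENNReal.ofReal (partialCount M A ω) =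
      ∑ n ∈ Finset.range M, ENNReal.ofReal (blockCount A (ω n)) := by
  rw [partialCount, ENNReal.ofReal_sum_of_nonneg fun _ _ => blockCount_nonneg _ _]

/-- Counts increase with the number of blocks, so events `count ≤ a` decrease and their
probabilities pass to the limit by continuity from above. This works even where the full count is
infinite. -/
theorem blockPoints_le_iff {A : Set X} (hA : MeasurableSet A) (a : ℝ≥0∞) :
    {ω : ℕ → ℕ × (ℕ → X) | blockPoints ω A ≤ a} =
      ⋂ M, {ω | ENNReal.ofReal (partialCount M A ω) ≤ a} := by
  ext ω
  simp only [mem_ofPred_eq, mem_iInter]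
  rw [blockPoints_apply hA, ENNReal.tsum_eq_iSup_nat, iSup_le_iff]
  simp_rw [ofReal_partialCount]

theorem measurable_blockPoints : Measurable (blockPoints (X := X)) := by
  refine Measure.measurable_of_measurable_coe _ fun A hA => ?_
  simp_rw [blockPoints_apply hA]
  exact Measurable.tsum fun n =>
    ((measurable_blockCount hA).comp (measurable_pi_apply n)).ennreal_ofReal

theorem antitone_partialCount_le {X : Type*} (A : Set X) (a : ℝ≥0∞) :
    Antitone fun M => {ω : ℕ → ℕ × (ℕ → X) | ENNReal.ofReal (partialCount M A ω) ≤ a} := by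
  intro M N h ω hω
  simp only [mem_ofPred_eq, ofReal_partialCount] at hω ⊢
  exact (Finset.sum_le_sum_of_subset (Finset.range_mono h)).trans hω

theorem measurableSet_partialCount_le (M : ℕ) {A : Set X} (hA : MeasurableSet A) (a : ℝ≥0∞) :
    MeasurableSet {ω : ℕ → ℕ × (ℕ → X) | ENNReal.ofReal (partialCount M A ω) ≤ a} :=
  measurableSet_le (measurable_partialCount M hA).ennreal_ofReal measurable_const

theorem tendsto_partialCount_le (P : Measure (ℕ → ℕ × (ℕ → X))) [IsFiniteMeasure P]
    {A : Set X} (hA : MeasurableSet A) (a : ℝ≥0∞) :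
    Tendsto (fun M => P {ω | ENNReal.ofReal (partialCount M A ω) ≤ a}) atTop
      (𝓝 (P {ω | blockPoints ω A ≤ a})) := by
  rw [blockPoints_le_iff hA]
  exact tendsto_measure_iInter_atTop
    (fun M => (measurableSet_partialCount_le M hA a).nullMeasurableSet)
    (antitone_partialCount_le A a) ⟨0, measure_ne_top _ _⟩

theorem blockPoints_isPoint (ω : ℕ → ℕ × (ℕ → X)) :
    ∃ (I : Set ℕ) (x : I → X), blockPoints ω = Measure.sum fun i : I => Measure.dirac (x i) := by
  -- A natural number encodes a pair (block, rank in the block); the index set keeps the ranks below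
  -- the number of points in the block.
  refine ⟨{i | i.unpair.2 < (ω i.unpair.1).1}, fun i => (ω (i : ℕ).unpair.1).2 (i : ℕ).unpair.2, ?_⟩
  ext A hA
  rw [blockPoints, Measure.sum_apply _ hA, Measure.sum_apply _ hA]
  rw [tsum_subtype {i : ℕ | i.unpair.2 < (ω i.unpair.1).1}
    (fun i => Measure.dirac ((ω i.unpair.1).2 i.unpair.2) A)]
  rw [← Equiv.tsum_eq Nat.pairEquiv (f := indicator {i : ℕ | i.unpair.2 < (ω i.unpair.1).1} _),
    ENNReal.tsum_prod']
  have hp : ∀ a b, Nat.pairEquiv (a, b) = Nat.pair a b := fun _ _ => rfl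
  congr 1; ext n
  rw [Measure.finsetSum_apply, tsum_eq_sum (s := Finset.range (ω n).1)]
  · refine Finset.sum_congr rfl fun k hk => ?_
    have : k < (ω n).1 := Finset.mem_range.mp hk
    simp [indicator, hp, this]
  · intro k hk
    have : ¬ k < (ω n).1 := by simpa using hk
    simp [indicator, hp, this]

end

theorem tendsto_poissonMeasure_le {r : ℕ → ℝ≥0} {s : ℝ≥0} (h : Tendsto r atTop (𝓝 s))
    (a : ℝ≥0∞) : Tendsto (fun M => poissonMeasure (r M) {n : ℕ | (n : ℝ≥0∞) ≤ a}) atTop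
      (𝓝 (poissonMeasure s {n : ℕ | (n : ℝ≥0∞) ≤ a})) := by
  by_cases ha : a = ∞
  · simp [ha]
  have hf : {n : ℕ | (n : ℝ≥0∞) ≤ a}.Finite := by
    refine (finite_Iic ⌊a.toReal⌋₊).subset fun n hn => ?_
    refine Nat.le_floor ?_
    have := ENNReal.toReal_mono ha hn
    simpa using this
  obtain ⟨F, hF⟩ := hf.exists_finset_coe
  rw [← hF]
  have : ∀ u, poissonMeasure u (F : Set ℕ) =
      ∑ n ∈ F, ENNReal.ofReal (Real.exp (-u) * u ^ n / n.factorial) := by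
    intro u
    rw [← sum_measure_singleton]
    simp_rw [poissonMeasure_singleton]
  simp_rw [this]
  refine tendsto_finsetSum _ fun n _ => ?_
  have hc : Continuous fun u : ℝ≥0 =>
      ENNReal.ofReal (Real.exp (-u) * u ^ n / n.factorial) :=
    ENNReal.continuous_ofReal.comp (by fun_prop)
  exact (hc.tendsto s).comp h

theorem isPoissonProcess_blockPoints {X : Type*} [MeasurableSpace X] (Λ q : ℕ → Measure X)
    [∀ n, IsFiniteMeasure (Λ n)] [∀ n, IsProbabilityMeasure (q n)]
    (hq : ∀ n, Λ n = Λ n univ • q n) :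
    IsPoissonProcess (blockMeasure Λ q) blockPoints (Measure.sum Λ) where
  measurable := measurable_blockPoints
  isPoint := blockPoints_isPoint
  count_law := by
    intro A hA hfin
    have hm : Measurable fun ω : ℕ → ℕ × (ℕ → X) => blockPoints ω A :=
      (Measure.measurable_coe hA).comp measurable_blockPoints
    have : IsProbabilityMeasure ((blockMeasure Λ q).map fun ω => blockPoints ω A) :=
      Measure.isProbabilityMeasure_map hm.aemeasurable
    refine Measure.ext_of_Iic _ _ fun a => ?_
    rw [Measure.map_apply hm measurableSet_Iic,
      Measure.map_apply (measurable_of_countable _) measurableSet_Iic]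
    refine tendsto_nhds_unique (tendsto_partialCount_le (blockMeasure Λ q) hA a) ?_
    have e : ∀ M, blockMeasure Λ q {ω | ENNReal.ofReal (partialCount M A ω) ≤ a} =
        poissonMeasure (∑ n ∈ Finset.range M, (Λ n A).toNNReal) {n : ℕ | (n : ℝ≥0∞) ≤ a} := by
      intro M
      have h1 := map_partialCount Λ q hq hA M
      have h2 : MeasurableSet {x : ℝ | ENNReal.ofReal x ≤ a} :=
        measurableSet_le ENNReal.measurable_ofReal measurable_const
      have h3 := congrArg (fun μ => μ {x : ℝ | ENNReal.ofReal x ≤ a}) h1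
      rw [Measure.map_apply (measurable_partialCount M hA) h2,
        Measure.map_apply (measurable_of_countable _) h2] at h3
      simpa using h3
    simp_rw [e]
    refine tendsto_poissonMeasure_le ?_ a
    rw [Measure.sum_apply _ hA] at hfin ⊢
    have h4 : ∀ n, Λ n A = ((Λ n A).toNNReal : ℝ≥0∞) := fun n =>
      (ENNReal.coe_toNNReal (measure_ne_top _ _)).symm
    have hs : Summable fun n => (Λ n A).toNNReal := by
      rw [← ENNReal.tsum_coe_ne_top_iff_summable]
      simpa using hfin
    have := hs.hasSum.tendsto_sum_nat
    convert this using 2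
    rw [tsum_congr h4, ← ENNReal.coe_tsum hs, ENNReal.toNNReal_coe]
  indep := by
    intro m A hA hd
    have hm : ∀ i, Measurable fun ω : ℕ → ℕ × (ℕ → X) => blockPoints ω (A i) := fun i =>
      (Measure.measurable_coe (hA i)).comp measurable_blockPoints
    -- Independence is checked on the π-systems of events `count ≤ a`, where it is inherited from
    -- finitely many blocks by monotone limits.
    refine iIndepSets.iIndep (fun i => (hm i).comap_le)
      (fun i => {s | ∃ a : ℝ≥0∞, s = {ω | blockPoints ω (A i) ≤ a}}) ?_ ?_ ?_
    · rintro i _ ⟨a, rfl⟩ _ ⟨b, rfl⟩ _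
      exact ⟨min a b, by ext; simp⟩
    · intro i
      rw [BorelSpace.measurable_eq (α := ℝ≥0∞), borel_eq_generateFrom_Iic,
        MeasurableSpace.comap_generateFrom]
      congr 1
      ext s
      simp only [mem_image, mem_range, exists_exists_eq_and, mem_ofPred_eq]
      exact ⟨fun ⟨a, h⟩ => ⟨a, h.symm⟩, fun ⟨a, h⟩ => ⟨a, h.symm⟩⟩
    · rw [iIndepSets_iff]
      intro s f hf
      have hf' : ∀ i, ∃ a : ℝ≥0∞, i ∈ s → f i = {ω | blockPoints ω (A i) ≤ a} := by
        intro i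
        by_cases hi : i ∈ s
        · obtain ⟨a, ha⟩ := hf i hi
          exact ⟨a, fun _ => ha⟩
        · exact ⟨0, fun h => absurd h hi⟩
      choose a ha using hf'
      have e1 : ⋂ i ∈ s, f i =
          ⋂ M, ⋂ i ∈ s, {ω | ENNReal.ofReal (partialCount M (A i) ω) ≤ a i} := by
        rw [iInter_comm]
        refine iInter_congr fun i => ?_
        by_cases hi : i ∈ s
        · simp [hi, ha i hi, blockPoints_le_iff (hA i)]
        · simp [hi]
      have e2 : ∏ i ∈ s, (blockMeasure Λ q) (f i) =
          ∏ i ∈ s, (blockMeasure Λ q) {ω | blockPoints ω (A i) ≤ a i} :=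
        Finset.prod_congr rfl fun i hi => by rw [ha i hi]
      rw [e1, e2]
      refine tendsto_nhds_unique (tendsto_measure_iInter_atTop (fun M => ?_) ?_
        ⟨0, measure_ne_top _ _⟩) ?_
      · exact (Finset.measurableSet_biInter _ fun i _ =>
          measurableSet_partialCount_le M (hA i) (a i)).nullMeasurableSet
      · exact fun M N h => iInter₂_mono fun i _ => antitone_partialCount_le (A i) (a i) h
      · have hi := fun M => (iIndepFun_partialCount Λ q hq A hA hd M).comp
          (fun _ => ENNReal.ofReal) (fun _ => ENNReal.measurable_ofReal)
        have e3 : ∀ M, blockMeasure Λ q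
            (⋂ i ∈ s, {ω | ENNReal.ofReal (partialCount M (A i) ω) ≤ a i}) =
            ∏ i ∈ s, blockMeasure Λ q {ω | ENNReal.ofReal (partialCount M (A i) ω) ≤ a i} := by
          intro M
          exact (hi M).measure_inter_preimage_eq_mul s (sets := fun i => Iic (a i))
            fun i _ => measurableSet_Iic
        simp only [Function.comp_def, e3]
        exact ENNReal.tendsto_finsetProd_of_ne_top _
          (fun i _ => tendsto_partialCount_le _ (hA i) (a i)) fun i _ => measure_ne_top _ _

theorem exists_isPoissonProcess {X : Type} [MeasurableSpace X] [Nonempty X] (Λ : Measure X)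
    [SFinite Λ] : ∃ (Ω : Type) (_ : MeasurableSpace Ω) (P : Measure Ω) (_ : IsProbabilityMeasure P)
      (ξ : Ω → Measure X), IsPoissonProcess P ξ Λ := by
  choose q hq hq' using fun n => exists_probability_smul (sfiniteSeq Λ n)
  refine ⟨_, _, blockMeasure (sfiniteSeq Λ) q, inferInstance, blockPoints, ?_⟩
  have := isPoissonProcess_blockPoints (sfiniteSeq Λ) q hq'
  rwa [sum_sfiniteSeq] at this

end PoissonExistence

/-! ### Void probabilities, superposition and independence -/

section VoidLaw

/-- `exp (-x)` for `x ∈ [0, ∞]`. -/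
noncomputable def expNeg (x : ℝ≥0∞) : ℝ≥0∞ :=
  if x = ∞ then 0 else ENNReal.ofReal (Real.exp (-x.toReal))

theorem expNeg_top : expNeg ∞ = 0 := by simp [expNeg]

theorem expNeg_of_ne_top {x : ℝ≥0∞} (h : x ≠ ∞) :
    expNeg x = ENNReal.ofReal (Real.exp (-x.toReal)) := by simp [expNeg, h]

theorem expNeg_add (x y : ℝ≥0∞) : expNeg (x + y) = expNeg x * expNeg y := by
  by_cases hx : x = ∞
  · simp [hx, expNeg_top]
  by_cases hy : y = ∞
  · simp [hy, expNeg_top]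
  rw [expNeg_of_ne_top hx, expNeg_of_ne_top hy, expNeg_of_ne_top (ENNReal.add_ne_top.2 ⟨hx, hy⟩),
    ENNReal.toReal_add hx hy, ← ENNReal.ofReal_mul (Real.exp_pos _).le, ← Real.exp_add]
  congr 2; ring

theorem one_sub_le_expNeg (x : ℝ≥0∞) : 1 - x ≤ expNeg x := by
  by_cases hx : x = ∞
  · simp [hx]
  rw [expNeg_of_ne_top hx]
  calc 1 - x = ENNReal.ofReal (1 - x.toReal) := by
        rw [ENNReal.ofReal_sub _ ENNReal.toReal_nonneg, ENNReal.ofReal_toReal hx, ENNReal.ofReal_one]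
    _ ≤ _ := ENNReal.ofReal_le_ofReal (by linarith [Real.add_one_le_exp (-x.toReal)])

theorem tendsto_expNeg_top : Tendsto expNeg (𝓝 ∞) (𝓝 0) := by
  rw [ENNReal.tendsto_nhds_zero]
  intro ε hε
  by_cases hε' : ε = ∞
  · simp [hε']
  have h0 : 0 < ε.toReal := ENNReal.toReal_pos hε.ne' hε'
  have h1 : ENNReal.ofReal (-Real.log ε.toReal) < ∞ := ENNReal.ofReal_lt_top
  filter_upwards [lt_mem_nhds h1] with x hx
  by_cases hx' : x = ∞
  · simp [hx', expNeg_top]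
  rw [expNeg_of_ne_top hx', ENNReal.ofReal_le_iff_le_toReal hε']
  have h2 : -Real.log ε.toReal < x.toReal := by
    by_contra! hc
    exact absurd hx (not_lt.2 (by rw [← ENNReal.ofReal_toReal hx']; exact ENNReal.ofReal_le_ofReal hc))
  calc Real.exp (-x.toReal) ≤ Real.exp (Real.log ε.toReal) := by
        apply Real.exp_le_exp.2; linarith
    _ = _ := Real.exp_log h0

variable {X : Type*} [MeasurableSpace X]

/-- `Q` is the law of a random measure whose void probabilities are those of a Poisson point
process with intensity `Λ`. -/
structure IsVoidLaw (Q : Measure (Measure X)) (Λ : Measure X) : Prop where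
  prob : IsProbabilityMeasure Q
  void : ∀ K, MeasurableSet K → Q {m | m K = 0} = expNeg (Λ K)

theorem measurableSet_void {K : Set X} (hK : MeasurableSet K) :
    MeasurableSet {m : Measure X | m K = 0} :=
  (Measure.measurable_coe hK) (measurableSet_singleton 0)

/-- The Poisson count law covers only sets of finite intensity; a set of infinite intensity is
exhausted by sets of finite intensity, whose void probabilities tend to `0`. -/
theorem IsPoissonProcess.void {Ω : Type*} [MeasurableSpace Ω] {P : Measure Ω}
    [IsProbabilityMeasure P] {ξ : Ω → Measure X} {Λ : Measure X} [SigmaFinite Λ]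
    (h : IsPoissonProcess P ξ Λ) {K : Set X} (hK : MeasurableSet K) :
    P {ω | ξ ω K = 0} = expNeg (Λ K) := by
  have hfin : ∀ K, MeasurableSet K → Λ K ≠ ∞ → P {ω | ξ ω K = 0} = expNeg (Λ K) := by
    intro K hK hfin
    have hm : Measurable fun ω => ξ ω K := (Measure.measurable_coe hK).comp h.measurable
    have h1 := congrArg (fun μ => μ {0}) (h.count_law K hK hfin)
    rw [Measure.map_apply hm (measurableSet_singleton 0),
      Measure.map_apply (measurable_of_countable _) (measurableSet_singleton 0)] at h1
    have h2 : (fun n : ℕ => (n : ℝ≥0∞)) ⁻¹' {0} = {0} := by ext; simp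
    rw [h2, poissonMeasure_singleton] at h1
    rw [expNeg_of_ne_top hfin]
    simpa [ENNReal.coe_toNNReal_eq_toReal, preimage] using h1
  by_cases hK' : Λ K = ∞
  · rw [hK', expNeg_top]
    have ht : Tendsto (fun n => expNeg (Λ (K ∩ spanningSets Λ n))) atTop (𝓝 0) := by
      refine tendsto_expNeg_top.comp ?_
      have := tendsto_measure_iUnion_atTop (μ := Λ) (s := fun n => K ∩ spanningSets Λ n)
        (fun i j hij => inter_subset_inter_right _ (monotone_spanningSets Λ hij))
      rwa [← inter_iUnion, iUnion_spanningSets, inter_univ, hK'] at this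
    refine le_antisymm (ge_of_tendsto' ht fun n => ?_) zero_le
    have hn : MeasurableSet (K ∩ spanningSets Λ n) := hK.inter (measurableSet_spanningSets Λ n)
    rw [← hfin _ hn ((measure_mono inter_subset_right).trans_lt
      (measure_spanningSets_lt_top Λ n)).ne]
    exact measure_mono fun ω hω => measure_mono_null inter_subset_left hω
  · exact hfin K hK hK'

theorem IsPoissonProcess.isVoidLaw {Ω : Type*} [MeasurableSpace Ω] {P : Measure Ω}
    [IsProbabilityMeasure P] {ξ : Ω → Measure X} {Λ : Measure X} [SigmaFinite Λ]
    (h : IsPoissonProcess P ξ Λ) : IsVoidLaw (P.map ξ) Λ where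
  prob := Measure.isProbabilityMeasure_map h.measurable.aemeasurable
  void K hK := by
    rw [Measure.map_apply h.measurable (measurableSet_void hK)]
    exact h.void hK

/-- The σ-algebra generated by the void events of the subsets of `U`. -/
@[reducible] def voidSigma (U : Set X) : MeasurableSpace (Measure X) :=
  MeasurableSpace.generateFrom {s | ∃ K, MeasurableSet K ∧ K ⊆ U ∧ s = {m | m K = 0}}

theorem voidSigma_mono {U V : Set X} (h : U ⊆ V) : voidSigma U ≤ voidSigma V :=
  MeasurableSpace.generateFrom_mono fun _ ⟨K, hK, hU, hs⟩ => ⟨K, hK, hU.trans h, hs⟩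

theorem voidSigma_le (U : Set X) : voidSigma U ≤ Measure.instMeasurableSpace := by
  refine MeasurableSpace.generateFrom_le ?_
  rintro _ ⟨K, hK, -, rfl⟩
  exact measurableSet_void hK

theorem isPiSystem_void (U : Set X) :
    IsPiSystem {s : Set (Measure X) | ∃ K, MeasurableSet K ∧ K ⊆ U ∧ s = {m | m K = 0}} := by
  rintro _ ⟨K, hK, hKU, rfl⟩ _ ⟨L, hL, hLU, rfl⟩ -
  exact ⟨K ∪ L, hK.union hL, union_subset hKU hLU, by ext; simp [measure_union_null_iff]⟩

/-- Being void on `K` and on `L` is being void on `K ∪ L`, so void events form a π-system and their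
probabilities determine the law on the σ-algebra they generate. This is what makes the choice of the
process immaterial. -/
theorem IsVoidLaw.unique {Q Q' : Measure (Measure X)} {Λ : Measure X} (h : IsVoidLaw Q Λ)
    (h' : IsVoidLaw Q' Λ) {s : Set (Measure X)} (hs : MeasurableSet[voidSigma univ] s) :
    Q s = Q' s := by
  have := h.prob
  have := h'.prob
  have hle := voidSigma_le (univ : Set X)
  have e : @Measure.trim _ (voidSigma univ) _ Q hle = @Measure.trim _ (voidSigma univ) _ Q' hle := by
    have : @IsFiniteMeasure _ (voidSigma univ) (Q.trim hle) := isFiniteMeasure_trim hle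
    refine @ext_of_generate_finite _ (voidSigma univ) _ _ _ rfl (isPiSystem_void univ) _ ?_ ?_
    · rintro _ ⟨K, hK, hKU, rfl⟩
      have hm : MeasurableSet[voidSigma univ] {m : Measure X | m K = 0} :=
        MeasurableSpace.measurableSet_generateFrom ⟨K, hK, hKU, rfl⟩
      rw [trim_measurableSet_eq hle hm, trim_measurableSet_eq hle hm, h.void K hK, h'.void K hK]
    · rw [trim_measurableSet_eq hle MeasurableSet.univ, trim_measurableSet_eq hle MeasurableSet.univ]
      simp
  rw [← trim_measurableSet_eq hle hs, e, trim_measurableSet_eq hle hs]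

/-- For disjoint `K` and `L`, `expNeg (Λ (K ∪ L))` factorizes; independence extends from void events
to the generated σ-algebras. -/
theorem IsVoidLaw.inter {Q : Measure (Measure X)} {Λ : Measure X} (h : IsVoidLaw Q Λ)
    {U V : Set X} (hUV : Disjoint U V) {s t : Set (Measure X)}
    (hs : MeasurableSet[voidSigma U] s) (ht : MeasurableSet[voidSigma V] t) :
    Q (s ∩ t) = Q s * Q t := by
  have := h.prob
  have hi : Indep (voidSigma U) (voidSigma V) Q := by
    refine IndepSets.indep (voidSigma_le U) (voidSigma_le V) (isPiSystem_void U)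
      (isPiSystem_void V) rfl rfl ?_
    rw [IndepSets_iff]
    rintro _ _ ⟨K, hK, hKU, rfl⟩ ⟨L, hL, hLV, rfl⟩
    have e : {m : Measure X | m K = 0} ∩ {m | m L = 0} = {m | m (K ∪ L) = 0} := by
      ext; simp [measure_union_null_iff]
    rw [e, h.void _ hK, h.void _ hL, h.void _ (hK.union hL),
      measure_union (hUV.mono hKU hLV) hL, expNeg_add]
  exact (Indep_iff _ _ Q).1 hi s t hs ht

theorem IsVoidLaw.measure_ne_zero_le {Q : Measure (Measure X)} {Λ : Measure X}
    (h : IsVoidLaw Q Λ) {K : Set X} (hK : MeasurableSet K) : Q {m | m K ≠ 0} ≤ Λ K := by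
  have := h.prob
  have e : {m : Measure X | m K ≠ 0} = {m | m K = 0}ᶜ := rfl
  rw [e, prob_compl_eq_one_sub (measurableSet_void hK), h.void K hK, tsub_le_iff_left,
    ← tsub_le_iff_right]
  exact one_sub_le_expNeg _

theorem measurable_measure_add :
    Measurable fun p : Measure X × Measure X => p.1 + p.2 := by
  refine Measure.measurable_of_measurable_coe _ fun s hs => ?_
  simp only [Measure.add_apply]
  exact ((Measure.measurable_coe hs).comp measurable_fst).add
    ((Measure.measurable_coe hs).comp measurable_snd)

theorem IsVoidLaw.add {Q Q' : Measure (Measure X)} {Λ Λ' : Measure X} (h : IsVoidLaw Q Λ)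
    (h' : IsVoidLaw Q' Λ') :
    IsVoidLaw ((Q.prod Q').map fun p => p.1 + p.2) (Λ + Λ') := by
  have := h.prob
  have := h'.prob
  refine ⟨Measure.isProbabilityMeasure_map measurable_measure_add.aemeasurable, fun K hK => ?_⟩
  rw [Measure.map_apply measurable_measure_add (measurableSet_void hK)]
  have e : (fun p : Measure X × Measure X => p.1 + p.2) ⁻¹' {m | m K = 0} =
      {m | m K = 0} ×ˢ {m | m K = 0} := by
    ext p; simp
  rw [e, Measure.prod_prod, h.void K hK, h'.void K hK, Measure.add_apply, expNeg_add]

theorem IsVoidLaw.map {Y : Type*} [MeasurableSpace Y] {Q : Measure (Measure X)} {Λ : Measure X}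
    (h : IsVoidLaw Q Λ) {φ : X → Y} (hφ : Measurable φ) :
    IsVoidLaw (Q.map (Measure.map φ)) (Λ.map φ) := by
  have := h.prob
  have hm := Measure.measurable_map φ hφ
  refine ⟨Measure.isProbabilityMeasure_map hm.aemeasurable, fun K hK => ?_⟩
  rw [Measure.map_apply hm (measurableSet_void hK), Measure.map_apply hφ hK,
    ← h.void _ (hφ hK)]
  congr 1
  ext m
  simp [Measure.map_apply hφ hK]

open Classical in
/-- A law with the void probabilities of a Poisson point process with intensity `Λ`. -/
noncomputable def voidLaw (Λ : Measure X) : Measure (Measure X) :=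
  if h : ∃ Q, IsVoidLaw Q Λ then h.choose else 0

theorem isVoidLaw_voidLaw {X : Type} [MeasurableSpace X] [Nonempty X] (Λ : Measure X)
    [SigmaFinite Λ] : IsVoidLaw (voidLaw Λ) Λ := by
  obtain ⟨Ω, _, P, _, ξ, h⟩ := exists_isPoissonProcess Λ
  have hex : ∃ Q, IsVoidLaw Q Λ := ⟨_, h.isVoidLaw⟩
  rw [voidLaw, dif_pos hex]
  exact hex.choose_spec

theorem IsPoissonProcess.measure_eq_voidLaw {X : Type} [MeasurableSpace X] [Nonempty X]
    {Ω : Type*} [MeasurableSpace Ω] {P : Measure Ω}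
    [IsProbabilityMeasure P] {ξ : Ω → Measure X} {Λ : Measure X} [SigmaFinite Λ]
    (h : IsPoissonProcess P ξ Λ) {s : Set (Measure X)} (hs : MeasurableSet[voidSigma univ] s) :
    P {ω | ξ ω ∈ s} = voidLaw Λ s := by
  rw [(isVoidLaw_voidLaw Λ).unique h.isVoidLaw hs,
    Measure.map_apply h.measurable (voidSigma_le _ _ hs)]
  rfl

section Law

variable {X : Type} [MeasurableSpace X] [Nonempty X] {Λ Λ' : Measure X} [SigmaFinite Λ]
  [SigmaFinite Λ']

theorem voidLaw_map {Y : Type} [MeasurableSpace Y] [Nonempty Y] {φ : X → Y} (hφ : Measurable φ)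
    [SigmaFinite (Λ.map φ)] {s : Set (Measure Y)} (hs : MeasurableSet[voidSigma univ] s) :
    voidLaw (Λ.map φ) s = voidLaw Λ {m | m.map φ ∈ s} := by
  rw [(isVoidLaw_voidLaw (Λ.map φ)).unique ((isVoidLaw_voidLaw Λ).map hφ) hs,
    Measure.map_apply (Measure.measurable_map φ hφ) (voidSigma_le _ _ hs)]
  rfl

/-- The sum of two independent copies realizes the intensity `Λ + Λ'`. No measurability of `t` and
`u` is needed, as the product formula for rectangles holds for arbitrary sets. -/
theorem voidLaw_add_le {s t u : Set (Measure X)} (hs : MeasurableSet[voidSigma univ] s)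
    (h : ∀ m m', m + m' ∈ s → m ∈ t ∨ m' ∈ u) :
    voidLaw (Λ + Λ') s ≤ voidLaw Λ t + voidLaw Λ' u := by
  have hQ := isVoidLaw_voidLaw Λ
  have hQ' := isVoidLaw_voidLaw Λ'
  have := hQ.prob
  have := hQ'.prob
  rw [(isVoidLaw_voidLaw (Λ + Λ')).unique (hQ.add hQ') hs,
    Measure.map_apply measurable_measure_add (voidSigma_le _ _ hs)]
  calc _ ≤ ((voidLaw Λ).prod (voidLaw Λ')) (t ×ˢ univ ∪ univ ×ˢ u) := by
        refine measure_mono fun p hp => ?_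
        simpa using h p.1 p.2 hp
    _ ≤ _ := measure_union_le _ _
    _ = _ := by simp [Measure.prod_prod]

theorem voidLaw_le_add {s t : Set (Measure X)} (ht : MeasurableSet[voidSigma univ] t)
    (h : ∀ m m', m ∈ s → m + m' ∈ t) :
    voidLaw Λ s ≤ voidLaw (Λ + Λ') t := by
  have hQ := isVoidLaw_voidLaw Λ
  have hQ' := isVoidLaw_voidLaw Λ'
  have := hQ.prob
  have := hQ'.prob
  rw [(isVoidLaw_voidLaw (Λ + Λ')).unique (hQ.add hQ') ht,
    Measure.map_apply measurable_measure_add (voidSigma_le _ _ ht)]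
  calc voidLaw Λ s = ((voidLaw Λ).prod (voidLaw Λ')) (s ×ˢ univ) := by simp [Measure.prod_prod]
    _ ≤ _ := measure_mono fun p hp => h p.1 p.2 hp.1

end Law

end VoidLaw

/-! ### Topology of paths crossing level sets -/

section Paths

theorem Path.joinedIn_range {E : Type*} [TopologicalSpace E] {u v : E} (γ : Path u v)
    {S : Set E} (h : ∀ t, γ t ∈ S) (s t : unitInterval) : JoinedIn S (γ s) (γ t) := by
  have : PathConnectedSpace unitInterval :=
    isPathConnected_iff_pathConnectedSpace.1
      ((convex_Icc (0 : ℝ) 1).isPathConnected ⟨0, by simp⟩)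
  have : IsPathConnected (range γ) := isPathConnected_range γ.continuous
  exact (this.joinedIn _ (mem_range_self s) _ (mem_range_self t)).mono (range_subset_iff.2 h)

theorem JoinedIn.pathConnects_level {E : Type*} [TopologicalSpace E] {S : Set E} {u v : E}
    (h : JoinedIn S u v) {f : E → ℝ} (hf : Continuous f) {a b : ℝ} (ha : f u ≤ a) (ha' : a ≤ f v)
    (hb : f u ≤ b) (hb' : b ≤ f v) : PathConnects {x | f x = a} {x | f x = b} S := by
  obtain ⟨γ, hγ⟩ := h
  have hc : Continuous fun t => f (γ t) := hf.comp γ.continuous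
  have key : ∀ c, f u ≤ c → c ≤ f v → ∃ t, f (γ t) = c := by
    intro c h1 h2
    have := mem_range_of_exists_le_of_exists_ge hc (c := c) ⟨0, by simpa using h1⟩
      ⟨1, by simpa using h2⟩
    exact this
  obtain ⟨s, hs⟩ := key a ha ha'
  obtain ⟨t, ht⟩ := key b hb hb'
  exact ⟨γ s, hs, γ t, ht, γ.joinedIn_range hγ s t⟩

theorem JoinedIn.truncate_level {E : Type*} [TopologicalSpace E] {S : Set E} {u v : E}
    (h : JoinedIn S u v) {f : E → ℝ} (hf : Continuous f) {b : ℝ} (hb : f u ≤ b) (hb' : b ≤ f v) :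
    ∃ v', f v' = b ∧ JoinedIn (S ∩ {x | f x ≤ b}) u v' := by
  obtain ⟨γ, hγ⟩ := h
  have hc : Continuous fun t => f (γ.extend t) := hf.comp γ.continuous_extend
  set T : Set ℝ := Icc 0 1 ∩ {t | b ≤ f (γ.extend t)} with hT
  have hTc : IsCompact T := isCompact_Icc.inter_right (isClosed_le continuous_const hc)
  have hTn : T.Nonempty := ⟨1, by simp [hT, hb']⟩
  obtain ⟨t₀, ht₀, hmin⟩ := hTc.exists_isLeast hTn
  -- Here `t₀` is the first time at which `f` is at least `b`. A value above `b` at some time `t ≤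
  -- t₀` would, by the intermediate value theorem, give a time `s ≤ t` with value exactly `b`;
  -- minimality then forces `s = t`, a contradiction.
  have hle : ∀ t ∈ Icc 0 t₀, f (γ.extend t) ≤ b := by
    intro t ht
    by_contra! hlt
    obtain ⟨s, hs, hs'⟩ := intermediate_value_Icc ht.1 hc.continuousOn
      (show b ∈ Icc (f (γ.extend 0)) (f (γ.extend t)) from ⟨by simpa using hb, hlt.le⟩)
    have h1 : t₀ ≤ s := hmin ⟨⟨hs.1, hs.2.trans (ht.2.trans ht₀.1.2)⟩, hs'.ge⟩
    have h2 : s = t := le_antisymm hs.2 (ht.2.trans h1)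
    rw [h2] at hs'
    exact absurd hs' (ne_of_gt hlt)
  have hp : IsPathConnected (γ.extend '' Icc 0 t₀) :=
    ((convex_Icc (0 : ℝ) t₀).isPathConnected ⟨0, by simp [ht₀.1.1]⟩).image γ.continuous_extend
  refine ⟨γ.extend t₀, le_antisymm (hle t₀ ⟨ht₀.1.1, le_rfl⟩) ht₀.2, ?_⟩
  have hj := hp.joinedIn (γ.extend 0) ⟨0, by simp [ht₀.1.1]⟩ (γ.extend t₀)
    ⟨t₀, by simp [ht₀.1.1], rfl⟩
  rw [γ.extend_zero] at hj
  refine hj.mono ?_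
  rintro _ ⟨t, ht, rfl⟩
  refine ⟨?_, hle t ht⟩
  rw [γ.extend_apply ⟨ht.1, ht.2.trans ht₀.1.2⟩]
  exact hγ _

theorem PathConnects.mono {E : Type*} [TopologicalSpace E] {A B S T : Set E}
    (h : PathConnects A B S) (hST : S ⊆ T) : PathConnects A B T := by
  obtain ⟨x, hx, y, hy, hj⟩ := h
  exact ⟨x, hx, y, hy, hj.mono hST⟩

theorem JoinedIn.pathConnects_sphere {E : Type*} [PseudoMetricSpace E] {S : Set E} {u v x : E}
    (h : JoinedIn S u v) {a b : ℝ} (hab : a ≤ b) (hu : dist u x ≤ a) (hv : b ≤ dist v x) :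
    PathConnects (Metric.sphere x a) (Metric.sphere x b) S :=
  h.pathConnects_level (f := fun y => dist y x) (by fun_prop) hu (hab.trans hv) (hu.trans hab) hv

theorem PathConnects.truncate_sphere {E : Type*} [PseudoMetricSpace E] {S : Set E} {x : E}
    {a b : ℝ} (hab : a ≤ b) (h : PathConnects (Metric.sphere x a) (Metric.sphere x b) S) :
    PathConnects (Metric.sphere x a) (Metric.sphere x b) (S ∩ Metric.closedBall x b) := by
  obtain ⟨u, hu, v, hv, hj⟩ := h
  obtain ⟨v', hv', hj'⟩ := hj.truncate_level (f := fun y => dist y x) (b := b) (by fun_prop)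
    (le_trans (le_of_eq hu) hab) (le_of_eq hv.symm)
  exact ⟨u, hu, v', hv', hj'⟩

/-- A path in `S₁ ∪ S₂`, where the components of `S₂` met by the path have diameter less than `δ`,
stays within distance `δ` of `S₁`. -/
theorem JoinedIn.of_union_of_small {E : Type*} [PseudoMetricSpace E] [LocallyPathConnectedSpace E]
    {S₁ S₂ T W : Set E} {u v : E} {δ : ℝ} (hδ : 0 < δ) (h₁ : IsOpen S₁) (h₂ : IsOpen S₂)
    (hj : JoinedIn ((S₁ ∪ S₂) ∩ W) u v)
    (hsmall : ∀ x ∈ W, ∀ y, JoinedIn S₂ x y → dist x y < δ) (huv : 2 * δ ≤ dist u v)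
    (hT : ∀ x ∈ W, ∀ y ∈ S₁, dist x y < δ → x ∈ T) : JoinedIn T u v := by
  obtain ⟨γ, hγ⟩ := hj
  refine ⟨γ, fun t => ?_⟩
  by_contra hx
  have hx₁ : γ t ∉ S₁ := fun h => hx (hT _ (hγ t).2 _ h (by simpa using hδ))
  have hx₂ : γ t ∈ S₂ := (hγ t).1.resolve_left hx₁
  set C := pathComponentIn S₂ (γ t) with hC
  have hCo : IsOpen C := h₂.pathComponentIn _
  -- The component `C` of the offending point avoids `S₁`, so `C` and `S₁ ∪ D` are disjoint open
  -- sets covering the path. By connectedness the whole path lies in `C`, which is too small to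
  -- contain both endpoints.
  have hC₁ : ∀ y ∈ C, y ∉ S₁ := fun y hy hy' => hx (hT _ (hγ t).2 y hy' (hsmall _ (hγ t).2 y hy))
  set D := ⋃ y ∈ S₂ \ C, pathComponentIn S₂ y with hD
  have hDo : IsOpen D := isOpen_biUnion fun y _ => h₂.pathComponentIn _
  have hCD : Disjoint C D := by
    rw [Set.disjoint_left]
    intro z hz hz'
    simp only [hD, mem_iUnion] at hz'
    obtain ⟨y, hy, hyz⟩ := hz'
    have hz1 : JoinedIn S₂ (γ t) z := hz
    have hz2 : JoinedIn S₂ y z := hyz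
    exact hy.2 (hz1.trans hz2.symm)
  have hr : range γ ⊆ C := by
    refine (isPreconnected_range γ.continuous).subset_left_of_subset_union hCo (h₁.union hDo)
      ?_ ?_ ⟨γ t, mem_range_self t, JoinedIn.refl hx₂⟩
    · rw [disjoint_union_right]
      exact ⟨Set.disjoint_left.2 hC₁, hCD⟩
    · rintro _ ⟨s, rfl⟩
      rcases (hγ s).1 with h | h
      · exact Or.inr (Or.inl h)
      · by_cases hs : γ s ∈ C
        · exact Or.inl hs
        · refine Or.inr (Or.inr ?_)
          simp only [hD, mem_iUnion]
          exact ⟨γ s, ⟨h, hs⟩, JoinedIn.refl h⟩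
  have hu : dist (γ t) u < δ := hsmall _ (hγ t).2 u (hr ⟨0, by simp⟩)
  have hv : dist (γ t) v < δ := hsmall _ (hγ t).2 v (hr ⟨1, by simp⟩)
  have := dist_triangle_left u v (γ t)
  linarith

end Paths

/-! ### The covered set and measurability of crossings -/

section BooleanModel

/-- The set covered by the balls of a counting measure: the points `x` such that some ball
`B(c, r)` of positive mass contains `x`. -/
def coveredSet {E : Type*} [PseudoMetricSpace E] [MeasurableSpace E] (m : Measure (E × ℝ)) :
    Set E :=
  {x | m {z | dist x z.1 < z.2} ≠ 0}

/-- The pairs `(c, r)` such that `B(c, r)` contains `B(x, s)`. -/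
def coverBall {E : Type*} [PseudoMetricSpace E] (x : E) (s : ℝ) : Set (E × ℝ) :=
  {z | dist x z.1 + s ≤ z.2}

variable {E : Type*} [PseudoMetricSpace E] [MeasurableSpace E]

theorem coveredSet_mono {m m' : Measure (E × ℝ)} (h : m ≤ m') : coveredSet m ⊆ coveredSet m' :=
  fun _ hx h0 => hx (le_antisymm (h0 ▸ h _) zero_le)

theorem coveredSet_add (m m' : Measure (E × ℝ)) :
    coveredSet (m + m') = coveredSet m ∪ coveredSet m' := by
  ext x
  simp only [coveredSet, Measure.add_apply, mem_union, mem_ofPred_eq, ne_eq, add_eq_zero]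
  tauto

variable [SecondCountableTopology E]

section

variable [BorelSpace E]

theorem measurableSet_dist_lt (x : E) : MeasurableSet {z : E × ℝ | dist x z.1 < z.2} :=
  measurableSet_lt (by fun_prop) (by fun_prop)

theorem measurableSet_coverBall (x : E) (s : ℝ) : MeasurableSet (coverBall x s) :=
  measurableSet_le (by fun_prop) (by fun_prop)

/-- For a sum of Dirac masses, a measurable set is charged exactly when it contains an atom. This
trades the union over atoms for void events. -/
theorem ballUnion_eq_coveredSet {d : ℕ} {m : Measure (EuclideanSpace ℝ (Fin d) × ℝ)}
    (h : ∃ (I : Set ℕ) (x : I → EuclideanSpace ℝ (Fin d) × ℝ),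
      m = Measure.sum fun i : I => Measure.dirac (x i)) : ballUnion m = coveredSet m := by
  obtain ⟨I, x, rfl⟩ := h
  ext y
  have key : ∀ A, MeasurableSet A →
      ((Measure.sum fun i : I => Measure.dirac (x i)) A ≠ 0 ↔ ∃ i, x i ∈ A) := by
    intro A hA
    rw [Measure.sum_apply _ hA]
    simp only [ne_eq, ENNReal.tsum_eq_zero, not_forall, Measure.dirac_apply' _ hA]
    simp [indicator]
  rw [coveredSet, mem_ofPred_eq, key _ (measurableSet_dist_lt y)]
  simp only [ballUnion, mem_iUnion, exists_prop]
  constructor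
  · rintro ⟨z, hz, hy⟩
    obtain ⟨i, hi⟩ := (key _ (measurableSet_singleton z)).1 hz
    refine ⟨i, ?_⟩
    rw [mem_singleton_iff] at hi
    rw [hi]
    simpa using hy
  · rintro ⟨i, hi⟩
    exact ⟨x i, (key _ (measurableSet_singleton _)).2 ⟨i, rfl⟩, hi⟩

end

variable [Nonempty E]

/-- A countable family of balls with rational radii and centers in a countable dense set. -/
noncomputable def rationalBall (E : Type*) [PseudoMetricSpace E] [SecondCountableTopology E]
    [Nonempty E] (i : ℕ × ℚ) : Set E :=
  Metric.ball (TopologicalSpace.denseSeq E i.1) i.2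

/-- Every ball containing `x` contains a rational ball containing `x`; as there are countably many
of these, being uncovered is a countable union of null conditions. -/
theorem mem_coveredSet_iff {m : Measure (E × ℝ)} {x : E} :
    x ∈ coveredSet m ↔ ∃ i : ℕ × ℚ, x ∈ rationalBall E i ∧
      m (coverBall (TopologicalSpace.denseSeq E i.1) i.2) ≠ 0 := by
  constructor
  · intro hx
    by_contra! hc
    refine hx (measure_mono_null (t := ⋃ i : {i : ℕ × ℚ // x ∈ rationalBall E i},
      coverBall (TopologicalSpace.denseSeq E i.1.1) i.1.2) ?_ ?_)
    · intro z hz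
      have hz' : dist x z.1 < z.2 := hz
      -- Half of the gap `z.2 - dist x z.1` pays for moving the center, the other half for the
      -- radius of the rational ball.
      obtain ⟨n, hn⟩ := (TopologicalSpace.denseRange_denseSeq E).exists_dist_lt x
        (show 0 < (z.2 - dist x z.1) / 2 by linarith)
      obtain ⟨s, hs1, hs2⟩ := exists_rat_btwn hn
      refine mem_iUnion.2 ⟨⟨(n, s), hs1⟩, ?_⟩
      change dist _ _ + _ ≤ _
      have := dist_triangle_left (TopologicalSpace.denseSeq E n) z.1 x
      simp only
      linarith
    · exact measure_iUnion_null fun i => hc i i.2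
  · rintro ⟨i, hx, hi⟩ h0
    refine hi (measure_mono_null ?_ h0)
    intro z hz
    have hz' : dist _ _ + _ ≤ _ := hz
    have hx' : dist x _ < _ := hx
    change dist x z.1 < z.2
    have := dist_triangle x (TopologicalSpace.denseSeq E i.1) z.1
    linarith

theorem isOpen_coveredSet (m : Measure (E × ℝ)) : IsOpen (coveredSet m) := by
  have : coveredSet m = ⋃ i ∈ {i : ℕ × ℚ |
      m (coverBall (TopologicalSpace.denseSeq E i.1) i.2) ≠ 0}, rationalBall E i := by
    ext x
    rw [mem_coveredSet_iff]
    simp [and_comm]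
  rw [this]
  exact isOpen_biUnion fun i _ => Metric.isOpen_ball

/-- A path is compact, so finitely many rational balls cover it. Crossing events thereby become
countable unions of finite intersections of complements of void events. -/
theorem pathConnects_coveredSet_iff {m : Measure (E × ℝ)} {A B : Set E} :
    PathConnects A B (coveredSet m) ↔ ∃ F : Finset (ℕ × ℚ),
      PathConnects A B (⋃ i ∈ F, rationalBall E i) ∧
      ∀ i ∈ F, m (coverBall (TopologicalSpace.denseSeq E i.1) i.2) ≠ 0 := by
  constructor
  · rintro ⟨x, hx, y, hy, γ, hγ⟩
    have hK : IsCompact (range γ) := isCompact_range γ.continuous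
    have hcov : range γ ⊆ ⋃ i : {i : ℕ × ℚ //
        m (coverBall (TopologicalSpace.denseSeq E i.1) i.2) ≠ 0}, rationalBall E i := by
      rintro _ ⟨t, rfl⟩
      obtain ⟨i, hi, hi'⟩ := mem_coveredSet_iff.1 (hγ t)
      exact mem_iUnion.2 ⟨⟨i, hi'⟩, hi⟩
    obtain ⟨F, hF⟩ := hK.elim_finite_subcover _ (fun i => Metric.isOpen_ball) hcov
    refine ⟨F.map (Function.Embedding.subtype _), ⟨x, hx, y, hy, γ, fun t => ?_⟩, ?_⟩
    · have := hF (mem_range_self t)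
      simp only [mem_iUnion] at this
      obtain ⟨i, hi, hi'⟩ := this
      simp only [mem_iUnion, Finset.mem_map]
      exact ⟨i, ⟨i, hi, rfl⟩, hi'⟩
    · simp only [Finset.mem_map]
      rintro _ ⟨i, _, rfl⟩
      exact i.2
  · rintro ⟨F, hF, hF'⟩
    refine hF.mono ?_
    intro x hx
    simp only [mem_iUnion] at hx
    obtain ⟨i, hi, hi'⟩ := hx
    exact mem_coveredSet_iff.2 ⟨i, hi', hF' i hi⟩

variable [BorelSpace E]

theorem measurableSet_pathConnects_restrict (A B : Set E) {U : Set (E × ℝ)}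
    (hU : MeasurableSet U) :
    MeasurableSet[voidSigma U]
      {m : Measure (E × ℝ) | PathConnects A B (coveredSet (m.restrict U))} := by
  have : {m : Measure (E × ℝ) | PathConnects A B (coveredSet (m.restrict U))} =
      ⋃ F ∈ {F : Finset (ℕ × ℚ) | PathConnects A B (⋃ i ∈ F, rationalBall E i)},
        ⋂ i ∈ F, {m : Measure (E × ℝ) |
          m (coverBall (TopologicalSpace.denseSeq E i.1) i.2 ∩ U) = 0}ᶜ := by
    ext m
    rw [mem_ofPred_eq, pathConnects_coveredSet_iff]
    simp only [Measure.restrict_apply (measurableSet_coverBall _ _), mem_iUnion, mem_iInter,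
      mem_compl_iff, mem_ofPred_eq, exists_prop]
  rw [this]
  refine MeasurableSet.biUnion (to_countable _) fun F _ => ?_
  refine Finset.measurableSet_biInter _ fun i _ => MeasurableSet.compl ?_
  exact MeasurableSpace.measurableSet_generateFrom
    ⟨_, (measurableSet_coverBall _ _).inter hU, inter_subset_right, rfl⟩

theorem measurableSet_pathConnects (A B : Set E) :
    MeasurableSet[voidSigma univ]
      {m : Measure (E × ℝ) | PathConnects A B (coveredSet m)} := by
  have := measurableSet_pathConnects_restrict A B (U := univ) MeasurableSet.univ
  simpa only [Measure.restrict_univ] using this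

end BooleanModel

/-! ### Crossing probabilities: monotonicity, scaling, translation -/

section CrossingProbability

/-- The product of the Lebesgue measure on `ℝ^d` by `μ`. -/
noncomputable abbrev boolIntensity (d : ℕ) (μ : Measure ℝ) :
    Measure (EuclideanSpace ℝ (Fin d) × ℝ) :=
  (volume : Measure (EuclideanSpace ℝ (Fin d))).prod μ

/-- The counting measures whose balls contain a path from `S(x, R / 2)` to `S(x, R)`. -/
def crossEvent {E : Type*} [PseudoMetricSpace E] [MeasurableSpace E] (x : E) (R : ℝ) :
    Set (Measure (E × ℝ)) :=
  {m | PathConnects (Metric.sphere x (R / 2)) (Metric.sphere x R) (coveredSet m)}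

/-- The counting measures whose balls with centers in `B(x, 2R)` contain a path from
`S(x, R / 2)` to `S(x, R)`. -/
def localCrossEvent {E : Type*} [PseudoMetricSpace E] [MeasurableSpace E] (x : E) (R : ℝ) :
    Set (Measure (E × ℝ)) :=
  {m | m.restrict (Metric.ball x (2 * R) ×ˢ univ) ∈ crossEvent x R}

/-- The probability that the Boolean model driven by `μ` contains a path from `S(r / 2)` to
`S(r)`. -/
noncomputable def crossProb (d : ℕ) (μ : Measure ℝ) (r : ℝ) : ℝ≥0∞ :=
  voidLaw (boolIntensity d μ) (crossEvent 0 r)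

/-- The local version of `crossProb`, for the balls with centers in `B(0, 2r)`. -/
noncomputable def localCrossProb (d : ℕ) (μ : Measure ℝ) (r : ℝ) : ℝ≥0∞ :=
  voidLaw (boolIntensity d μ) (localCrossEvent 0 r)

section

variable {E : Type*} [PseudoMetricSpace E] [MeasurableSpace E]

theorem crossEvent_mono {x : E} {R : ℝ} {m m' : Measure (E × ℝ)}
    (hm : m ∈ crossEvent x R) (h : m ≤ m') : m' ∈ crossEvent x R :=
  PathConnects.mono hm (coveredSet_mono h)

theorem localCrossEvent_subset (x : E) (R : ℝ) : localCrossEvent x R ⊆ crossEvent x R :=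
  fun _ hm => crossEvent_mono hm Measure.restrict_le_self

variable [SecondCountableTopology E] [BorelSpace E] [Nonempty E]

theorem measurableSet_crossEvent (x : E) (R : ℝ) :
    MeasurableSet[voidSigma univ] (crossEvent x R) :=
  measurableSet_pathConnects _ _

theorem measurableSet_localCrossEvent (x : E) (R : ℝ) :
    MeasurableSet[voidSigma (Metric.ball x (2 * R) ×ˢ univ)] (localCrossEvent x R) :=
  measurableSet_pathConnects_restrict _ _ (Metric.isOpen_ball.measurableSet.prod MeasurableSet.univ)

end

theorem PathConnects.map {X Y : Type*} [TopologicalSpace X] [TopologicalSpace Y] {A B S : Set X}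
    {A' B' T : Set Y} (h : PathConnects A B S) {f : X → Y} (hf : Continuous f)
    (hA : MapsTo f A A') (hB : MapsTo f B B') (hS : MapsTo f S T) : PathConnects A' B' T := by
  obtain ⟨x, hx, y, hy, hj⟩ := h
  exact ⟨f x, hA hx, f y, hB hy, (hj.map hf).mono hS.image_subset⟩

/-- Existence of a Poisson process rules out vacuity of the universal quantifier; uniqueness on void
events makes all processes give the same probability. -/
theorem crossingVanishes_iff (d : ℕ) (μ : Measure ℝ) [IsFiniteMeasure μ] :
    CrossingVanishes d μ ↔ Tendsto (crossProb d μ) atTop (𝓝 0) := by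
  have key : ∀ (Ω : Type) [MeasurableSpace Ω] (P : Measure Ω) [IsProbabilityMeasure P]
      (ξ : Ω → Measure (EuclideanSpace ℝ (Fin d) × ℝ)),
      IsPoissonProcess P ξ (boolIntensity d μ) → ∀ r,
        P {ω | PathConnects (Metric.sphere 0 (r / 2)) (Metric.sphere 0 r) (ballUnion (ξ ω))} =
        crossProb d μ r := by
    intro Ω _ P _ ξ h r
    rw [crossProb, ← h.measure_eq_voidLaw (measurableSet_crossEvent 0 r)]
    congr 1
    ext ω
    simp only [mem_ofPred_eq, crossEvent, ballUnion_eq_coveredSet (h.isPoint ω)]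
  constructor
  · intro h
    obtain ⟨Ω, _, P, _, ξ, hξ⟩ := exists_isPoissonProcess (boolIntensity d μ)
    have := h Ω P ξ hξ
    simp_rw [key Ω P ξ hξ] at this
    exact this
  · intro h Ω _ P _ ξ hξ
    simp_rw [key Ω P ξ hξ]
    exact h

theorem crossProb_le_add (d : ℕ) (μ μ' : Measure ℝ) [IsFiniteMeasure μ] [IsFiniteMeasure μ']
    (r : ℝ) : crossProb d μ r ≤ crossProb d (μ + μ') r := by
  rw [crossProb, crossProb, boolIntensity, boolIntensity, Measure.prod_add]
  refine voidLaw_le_add (measurableSet_crossEvent 0 r) fun m m' hm => ?_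
  exact crossEvent_mono hm (Measure.le_add_right le_rfl)

theorem CrossingVanishes.of_add {d : ℕ} {μ μ' : Measure ℝ} [IsFiniteMeasure μ]
    [IsFiniteMeasure μ'] (h : CrossingVanishes d (μ + μ')) : CrossingVanishes d μ := by
  rw [crossingVanishes_iff] at h ⊢
  exact tendsto_of_tendsto_of_tendsto_of_le_of_le tendsto_const_nhds h (fun _ => zero_le)
    (crossProb_le_add d μ μ')

instance isFiniteMeasure_ofReal_smul (a : ℝ) (μ : Measure ℝ) [IsFiniteMeasure μ] :
    IsFiniteMeasure (ENNReal.ofReal a • μ) := μ.smul_finite ENNReal.ofReal_ne_top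

instance isFiniteMeasure_scaleMeasure (d : ℕ) (ρ : ℝ) (μ : Measure ℝ) [IsFiniteMeasure μ] :
    IsFiniteMeasure (scaleMeasure d ρ μ) :=
  Measure.smul_finite _ (ENNReal.pow_ne_top ENNReal.ofReal_ne_top)

/-- The map `(c, r) ↦ (c / ρ, r / ρ)`. -/
noncomputable def shrink {E : Type*} [SMul ℝ E] (ρ : ℝ) : E × ℝ → E × ℝ :=
  Prod.map (fun x => ρ⁻¹ • x) (fun r => r / ρ)

/-- The factor `ρ ^ d` in `scaleMeasure` is the Jacobian of the contraction of the centers. -/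
theorem boolIntensity_scaleMeasure (d : ℕ) {ρ : ℝ} (hρ : 0 < ρ) (μ : Measure ℝ)
    [IsFiniteMeasure μ] :
    boolIntensity d (scaleMeasure d ρ μ) = (boolIntensity d μ).map (shrink ρ) := by
  have hm : Measurable fun x : EuclideanSpace ℝ (Fin d) => ρ⁻¹ • x := by fun_prop
  have hm' : Measurable fun r : ℝ => r / ρ := by fun_prop
  rw [shrink, boolIntensity, ← Measure.map_prod_map _ _ hm hm',
    Measure.map_addHaar_smul _ (inv_ne_zero hρ.ne'), Measure.prod_smul_left, scaleMeasure,
    Measure.prod_smul_right]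
  congr 1
  rw [finrank_euclideanSpace_fin, inv_pow, inv_inv, abs_of_pos (pow_pos hρ d),
    ENNReal.ofReal_pow hρ.le]

theorem measurable_shrink (d : ℕ) (ρ : ℝ) :
    Measurable (shrink ρ : EuclideanSpace ℝ (Fin d) × ℝ → _) := by
  unfold shrink; fun_prop

theorem mem_coveredSet_map_shrink {d : ℕ} {ρ : ℝ} (hρ : 0 < ρ)
    (m : Measure (EuclideanSpace ℝ (Fin d) × ℝ)) (x : EuclideanSpace ℝ (Fin d)) :
    x ∈ coveredSet (m.map (shrink ρ)) ↔ ρ • x ∈ coveredSet m := by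
  rw [coveredSet, mem_ofPred_eq, Measure.map_apply (measurable_shrink d ρ) (measurableSet_dist_lt x),
    coveredSet, mem_ofPred_eq]
  have : shrink ρ ⁻¹' {z : EuclideanSpace ℝ (Fin d) × ℝ | dist x z.1 < z.2} =
      {z | dist (ρ • x) z.1 < z.2} := by
    ext z
    simp only [shrink, mem_preimage, mem_ofPred_eq, Prod.map_fst, Prod.map_snd]
    rw [lt_div_iff₀ hρ]
    have : dist (ρ • x) z.1 = dist x (ρ⁻¹ • z.1) * ρ := by
      have h : z.1 = ρ • (ρ⁻¹ • z.1) := by rw [smul_inv_smul₀ hρ.ne']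
      conv_lhs => rw [h, dist_smul₀, Real.norm_of_nonneg hρ.le, mul_comm]
    rw [this]
  rw [this]

theorem map_shrink_mem_crossEvent {d : ℕ} {ρ : ℝ} (hρ : 0 < ρ)
    (m : Measure (EuclideanSpace ℝ (Fin d) × ℝ)) (r : ℝ) :
    m.map (shrink ρ) ∈ crossEvent 0 r ↔ m ∈ crossEvent 0 (ρ * r) := by
  constructor
  · intro h
    refine PathConnects.map h (f := fun x => ρ • x) (by fun_prop) ?_ ?_ fun x hx => ?_
    · intro x hx
      rw [mem_sphere_zero_iff_norm] at hx ⊢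
      rw [norm_smul, hx, Real.norm_of_nonneg hρ.le]; ring
    · intro x hx
      rw [mem_sphere_zero_iff_norm] at hx ⊢
      rw [norm_smul, hx, Real.norm_of_nonneg hρ.le]
    · exact (mem_coveredSet_map_shrink hρ m x).1 hx
  · intro h
    refine PathConnects.map h (f := fun x => ρ⁻¹ • x) (by fun_prop) ?_ ?_ fun x hx => ?_
    · intro x hx
      rw [mem_sphere_zero_iff_norm] at hx ⊢
      rw [norm_smul, hx, norm_inv, Real.norm_of_nonneg hρ.le]; field_simp
    · intro x hx
      rw [mem_sphere_zero_iff_norm] at hx ⊢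
      rw [norm_smul, hx, norm_inv, Real.norm_of_nonneg hρ.le]; field_simp
    · rw [mem_coveredSet_map_shrink hρ, smul_inv_smul₀ hρ.ne']
      exact hx

theorem crossProb_scaleMeasure (d : ℕ) {ρ : ℝ} (hρ : 0 < ρ) (μ : Measure ℝ) [IsFiniteMeasure μ]
    (r : ℝ) : crossProb d (scaleMeasure d ρ μ) r = crossProb d μ (ρ * r) := by
  have hs : SigmaFinite ((boolIntensity d μ).map (shrink ρ)) := by
    rw [← boolIntensity_scaleMeasure d hρ]; infer_instance
  rw [crossProb, crossProb, boolIntensity_scaleMeasure d hρ,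
    voidLaw_map (measurable_shrink d ρ) (measurableSet_crossEvent 0 r)]
  congr 1
  ext m
  exact map_shrink_mem_crossEvent hρ m r

theorem crossingVanishes_scaleMeasure (d : ℕ) {ρ : ℝ} (hρ : 0 < ρ) (μ : Measure ℝ)
    [IsFiniteMeasure μ] : CrossingVanishes d (scaleMeasure d ρ μ) ↔ CrossingVanishes d μ := by
  rw [crossingVanishes_iff, crossingVanishes_iff]
  have e : crossProb d (scaleMeasure d ρ μ) = crossProb d μ ∘ fun r => ρ * r :=
    funext fun r => crossProb_scaleMeasure d hρ μ r
  have e' : crossProb d μ = crossProb d (scaleMeasure d ρ μ) ∘ fun r => ρ⁻¹ * r := by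
    ext r
    rw [Function.comp_apply, crossProb_scaleMeasure d hρ, mul_inv_cancel_left₀ hρ.ne']
  constructor
  · intro h
    rw [e']
    exact h.comp (tendsto_id.const_mul_atTop (inv_pos.2 hρ))
  · intro h
    rw [e]
    exact h.comp (tendsto_id.const_mul_atTop hρ)

theorem scaleMeasure_smul (d : ℕ) (ρ : ℝ) (c : ℝ≥0∞) (μ : Measure ℝ) :
    scaleMeasure d ρ (c • μ) = c • scaleMeasure d ρ μ := by
  rw [scaleMeasure, scaleMeasure, Measure.map_smul, smul_comm]

theorem scaleMeasure_nnreal_smul (d : ℕ) (ρ : ℝ) (c : ℝ≥0) (μ : Measure ℝ) :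
    scaleMeasure d ρ (c • μ) = c • scaleMeasure d ρ μ :=
  scaleMeasure_smul d ρ (c : ℝ≥0∞) μ

theorem voidLaw_restrict_mem_crossEvent (d : ℕ) (μ : Measure ℝ) [IsFiniteMeasure μ]
    (x : EuclideanSpace ℝ (Fin d)) (R : ℝ) {U U' : Set (EuclideanSpace ℝ (Fin d) × ℝ)}
    (hU : MeasurableSet U)
    (hUU' : Prod.map (fun y => y + x) id ⁻¹' U = U') :
    voidLaw (boolIntensity d μ) {m | m.restrict U ∈ crossEvent x R} =
      voidLaw (boolIntensity d μ) {m | m.restrict U' ∈ crossEvent 0 R} := by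
  set τ : EuclideanSpace ℝ (Fin d) × ℝ → EuclideanSpace ℝ (Fin d) × ℝ :=
    Prod.map (fun y => y + x) id with hτ
  have hτm : Measurable τ := by rw [hτ]; fun_prop
  have e : (boolIntensity d μ).map τ = boolIntensity d μ := by
    rw [hτ, boolIntensity, ← Measure.map_prod_map _ _ (by fun_prop) measurable_id,
      map_add_right_eq_self, Measure.map_id]
  have hs : SigmaFinite ((boolIntensity d μ).map τ) := by rw [e]; infer_instance
  have hcov : ∀ (m : Measure (EuclideanSpace ℝ (Fin d) × ℝ)) y,
      y + x ∈ coveredSet ((m.map τ).restrict U) ↔ y ∈ coveredSet (m.restrict U') := by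
    intro m y
    rw [coveredSet, coveredSet, mem_ofPred_eq, mem_ofPred_eq,
      Measure.restrict_apply (measurableSet_dist_lt _),
      Measure.restrict_apply (measurableSet_dist_lt _),
      Measure.map_apply hτm ((measurableSet_dist_lt _).inter hU), preimage_inter, hUU']
    have : τ ⁻¹' {z | dist (y + x) z.1 < z.2} = {z | dist y z.1 < z.2} := by
      ext z
      simp [hτ, dist_eq_norm]
    rw [this]
  have hmeas : MeasurableSet[voidSigma univ]
      {m : Measure (EuclideanSpace ℝ (Fin d) × ℝ) | m.restrict U ∈ crossEvent x R} :=
    voidSigma_mono (subset_univ _) _ (measurableSet_pathConnects_restrict _ _ hU)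
  conv_lhs => rw [← e]
  rw [voidLaw_map hτm hmeas]
  congr 1
  ext m
  constructor
  · intro h
    refine PathConnects.map h (f := fun y => y - x) (by fun_prop) ?_ ?_ fun y hy => ?_
    · intro y hy; simpa [dist_eq_norm] using hy
    · intro y hy; simpa [dist_eq_norm] using hy
    · rw [← hcov, sub_add_cancel]; exact hy
  · intro h
    refine PathConnects.map h (f := fun y => y + x) (by fun_prop) ?_ ?_ fun y hy => ?_
    · intro y hy; simpa [dist_eq_norm] using hy
    · intro y hy; simpa [dist_eq_norm] using hy
    · rw [hcov]; exact hy

/-- The probability of a local crossing does not depend on the center. -/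
theorem voidLaw_localCrossEvent (d : ℕ) (μ : Measure ℝ) [IsFiniteMeasure μ]
    (x : EuclideanSpace ℝ (Fin d)) (R : ℝ) :
    voidLaw (boolIntensity d μ) (localCrossEvent x R) = localCrossProb d μ R := by
  refine voidLaw_restrict_mem_crossEvent d μ x R
    (Metric.isOpen_ball.measurableSet.prod MeasurableSet.univ) ?_
  ext z
  simp [dist_eq_norm]

/-- The probability of a crossing does not depend on the center. -/
theorem voidLaw_crossEvent (d : ℕ) (μ : Measure ℝ) [IsFiniteMeasure μ]
    (x : EuclideanSpace ℝ (Fin d)) (R : ℝ) :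
    voidLaw (boolIntensity d μ) (crossEvent x R) = crossProb d μ R := by
  have := voidLaw_restrict_mem_crossEvent d μ x R (U := univ) MeasurableSet.univ preimage_univ
  simp only [Measure.restrict_univ] at this
  exact this

end CrossingProbability

/-! ### Elementary properties of the critical parameter -/

section LambdaHat

theorem crossingVanishes_smul_of_le {d : ℕ} {μ : Measure ℝ} [IsFiniteMeasure μ] {l l' : ℝ≥0}
    (hl : l ≤ l') (h : CrossingVanishes d (l' • μ)) : CrossingVanishes d (l • μ) := by
  have e : l' • μ = l • μ + (l' - l) • μ := by rw [← add_smul, add_tsub_cancel_of_le hl]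
  rw [e] at h
  exact h.of_add

theorem crossingVanishes_of_lt_lambdaHat {d : ℕ} {μ : Measure ℝ} [IsFiniteMeasure μ] {l : ℝ≥0}
    (hl : (l : ℝ≥0∞) < lambdaHat d μ) : CrossingVanishes d (l • μ) := by
  obtain ⟨_, ⟨l', ⟨_, h⟩, rfl⟩, hlt⟩ := lt_sSup_iff.1 hl
  exact crossingVanishes_smul_of_le (ENNReal.coe_le_coe.1 hlt.le) h

theorem le_lambdaHat {d : ℕ} {μ : Measure ℝ} {l : ℝ≥0} (h : CrossingVanishes d (l • μ)) :
    (l : ℝ≥0∞) ≤ lambdaHat d μ := by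
  rcases eq_or_lt_of_le (zero_le : 0 ≤ l) with h0 | h0
  · simp [← h0]
  · exact le_sSup ⟨l, ⟨h0, h⟩, rfl⟩

theorem lambdaHat_le {d : ℕ} {μ : Measure ℝ} {b : ℝ≥0∞}
    (h : ∀ l : ℝ≥0, CrossingVanishes d (l • μ) → (l : ℝ≥0∞) ≤ b) : lambdaHat d μ ≤ b := by
  refine sSup_le ?_
  rintro _ ⟨l, ⟨_, hl⟩, rfl⟩
  exact h l hl

theorem lambdaHat_add_le (d : ℕ) (μ μ' : Measure ℝ) [IsFiniteMeasure μ] [IsFiniteMeasure μ'] :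
    lambdaHat d (μ + μ') ≤ lambdaHat d μ := by
  refine lambdaHat_le fun l hl => le_lambdaHat ?_
  rw [smul_add] at hl
  exact hl.of_add

theorem nnreal_smul_ofReal_smul (l : ℝ≥0) (a : ℝ) (μ : Measure ℝ) :
    l • ENNReal.ofReal a • μ = (l * a.toNNReal) • μ := by
  rw [mul_smul]; rfl

theorem lambdaHat_ofReal_smul (d : ℕ) {a : ℝ} (ha : 0 < a) (μ : Measure ℝ) :
    lambdaHat d (ENNReal.ofReal a • μ) = lambdaHat d μ / ENNReal.ofReal a := by
  have h0 : ENNReal.ofReal a ≠ 0 := by simpa using ha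
  have h0' : a.toNNReal ≠ 0 := by simpa using ha
  refine le_antisymm (lambdaHat_le fun l hl => ?_) ?_
  · rw [nnreal_smul_ofReal_smul] at hl
    rw [ENNReal.le_div_iff_mul_le (Or.inl h0) (Or.inl ENNReal.ofReal_ne_top)]
    exact_mod_cast le_lambdaHat hl
  · refine ENNReal.div_le_of_le_mul (lambdaHat_le fun l hl => ?_)
    have h1 : CrossingVanishes d ((l / a.toNNReal) • ENNReal.ofReal a • μ) := by
      rwa [nnreal_smul_ofReal_smul, div_mul_cancel₀ _ h0']
    have h2 := mul_le_mul_left (le_lambdaHat h1) (ENNReal.ofReal a)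
    refine le_trans (le_of_eq ?_) h2
    have : l = l / a.toNNReal * a.toNNReal := (div_mul_cancel₀ _ h0').symm
    rw [ENNReal.ofReal, ← ENNReal.coe_mul, ← this]

theorem lambdaHat_scaleMeasure (d : ℕ) {ρ : ℝ} (hρ : 0 < ρ) (μ : Measure ℝ) [IsFiniteMeasure μ] :
    lambdaHat d (scaleMeasure d ρ μ) = lambdaHat d μ := by
  have : ∀ l : ℝ≥0, CrossingVanishes d (l • scaleMeasure d ρ μ) ↔ CrossingVanishes d (l • μ) := by
    intro l
    rw [← scaleMeasure_nnreal_smul, crossingVanishes_scaleMeasure d hρ]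
  simp only [lambdaHat, this]

end LambdaHat

/-! ### Deterministic connectivity of hierarchical blocks -/

section HierarchicalBlocks

/-- A block of level `n + 1` is bad when at least two of its nine subblocks of level `n` are bad. -/
def BadBlock (good : ℕ × ℕ → Prop) : ℕ → ℕ × ℕ → Prop
  | 0, P => ¬ good P
  | n + 1, P => ∃ s t : Fin 3 × Fin 3, s ≠ t ∧
      BadBlock good n (3 * P.1 + s.1, 3 * P.2 + s.2) ∧
      BadBlock good n (3 * P.1 + t.1, 3 * P.2 + t.2)

theorem connected_fin_three {J : Fin 3 → Fin 3 → Prop} (hs : ∀ x y, J x y → J y x)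
    (ht : ∀ x y z, J x y → J y z → J x z) (h0 : J 0 1) (h1 : J 1 2) (x y : Fin 3) : J x y := by
  have h2 := ht _ _ _ h0 h1
  have r0 := ht _ _ _ h0 (hs _ _ h0)
  have r1 := ht _ _ _ (hs _ _ h0) h0
  have r2 := ht _ _ _ (hs _ _ h1) h1
  fin_cases x <;> fin_cases y <;> simp <;> first | assumption | (apply hs; assumption)

/-- Rows and columns avoiding `e` are fully connected, and every cell other than `e` lies on one of
them. All are linked to a hub at the intersection of such a row and such a column. -/
theorem connected_grid_three {J : Fin 3 × Fin 3 → Fin 3 × Fin 3 → Prop}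
    (hs : ∀ x y, J x y → J y x) (ht : ∀ x y z, J x y → J y z → J x z) (e : Fin 3 × Fin 3)
    (hr : ∀ b, b ≠ e.2 → J (0, b) (1, b) ∧ J (1, b) (2, b))
    (hc : ∀ a, a ≠ e.1 → J (a, 0) (a, 1) ∧ J (a, 1) (a, 2)) {x y : Fin 3 × Fin 3}
    (hx : x ≠ e) (hy : y ≠ e) : J x y := by
  have row : ∀ b, b ≠ e.2 → ∀ a a', J (a, b) (a', b) := fun b hb =>
    connected_fin_three (J := fun a a' => J (a, b) (a', b)) (fun _ _ => hs _ _)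
      (fun _ _ _ => ht _ _ _) (hr b hb).1 (hr b hb).2
  have col : ∀ a, a ≠ e.1 → ∀ b b', J (a, b) (a, b') := fun a ha =>
    connected_fin_three (J := fun b b' => J (a, b) (a, b')) (fun _ _ => hs _ _)
      (fun _ _ _ => ht _ _ _) (hc a ha).1 (hc a ha).2
  obtain ⟨a₀, ha₀⟩ := exists_ne e.1
  obtain ⟨b₀, hb₀⟩ := exists_ne e.2
  have hub : ∀ z, z ≠ e → J z (a₀, b₀) := by
    rintro ⟨z1, z2⟩ hz
    by_cases h1 : z1 = e.1
    · have h2 : z2 ≠ e.2 := fun h2 => hz (Prod.ext h1 h2)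
      exact ht _ _ _ (row z2 h2 z1 a₀) (col a₀ ha₀ z2 b₀)
    · exact ht _ _ _ (col z1 h1 z2 b₀) (row b₀ hb₀ z1 a₀)
  exact ht _ _ _ (hub x hx) (hs _ _ (hub y hy))

theorem exists_ne_ne_fin_three (a b : Fin 3) : ∃ c, c ≠ a ∧ c ≠ b := by
  decide +revert

/-- A block that is not bad has at most one bad subblock, so its other subblocks are mutually
connected and any of them can provide the representative. Between two adjacent such blocks, at least
one of the three rows (or columns) meets neither bad subblock, and it carries the connection. -/
theorem exists_block_representatives {good : ℕ × ℕ → Prop} {J : ℕ × ℕ → ℕ × ℕ → Prop}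
    (hs : ∀ x y, J x y → J y x) (ht : ∀ x y z, J x y → J y z → J x z)
    (h1 : ∀ p : ℕ × ℕ, good p → good (p.1 + 1, p.2) → J p (p.1 + 1, p.2))
    (h2 : ∀ p : ℕ × ℕ, good p → good (p.1, p.2 + 1) → J p (p.1, p.2 + 1)) (n : ℕ) :
    ∃ rep : ℕ × ℕ → ℕ × ℕ,
      (∀ P, 3 ^ n * P.1 ≤ (rep P).1 ∧ (rep P).1 < 3 ^ n * (P.1 + 1) ∧
        3 ^ n * P.2 ≤ (rep P).2 ∧ (rep P).2 < 3 ^ n * (P.2 + 1)) ∧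
      (∀ P : ℕ × ℕ, ¬ BadBlock good n P → ¬ BadBlock good n (P.1 + 1, P.2) →
        J (rep P) (rep (P.1 + 1, P.2))) ∧
      (∀ P : ℕ × ℕ, ¬ BadBlock good n P → ¬ BadBlock good n (P.1, P.2 + 1) →
        J (rep P) (rep (P.1, P.2 + 1))) := by
  induction n with
  | zero =>
    refine ⟨id, fun P => by simp, fun P hP hP' => ?_, fun P hP hP' => ?_⟩
    · exact h1 P (not_not.1 hP) (not_not.1 hP')
    · exact h2 P (not_not.1 hP) (not_not.1 hP')
  | succ n ih =>
    obtain ⟨rep, hrep, hh, hv⟩ := ih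
    -- `e` is the possible bad subblock; if none is bad, the value `0` is arbitrary.
    have hex : ∀ P, ∃ e : Fin 3 × Fin 3, ¬ BadBlock good (n + 1) P →
        ∀ s, s ≠ e → ¬ BadBlock good n (3 * P.1 + s.1, 3 * P.2 + s.2) := by
      intro P
      by_cases hb : ∃ e : Fin 3 × Fin 3, BadBlock good n (3 * P.1 + e.1, 3 * P.2 + e.2)
      · obtain ⟨e, he⟩ := hb
        exact ⟨e, fun hP s hse hbs => hP ⟨s, e, hse, hbs, he⟩⟩
      · push Not at hb
        exact ⟨0, fun _ s _ => hb s⟩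
    choose e he using hex
    choose h hhub using fun P => exists_ne (e P)
    have hin : ∀ P, ¬ BadBlock good (n + 1) P → ∀ s t, s ≠ e P → t ≠ e P →
        J (rep (3 * P.1 + s.1, 3 * P.2 + s.2)) (rep (3 * P.1 + t.1, 3 * P.2 + t.2)) := by
      intro P hP s t hs' ht'
      refine connected_grid_three (J := fun s t : Fin 3 × Fin 3 =>
        J (rep (3 * P.1 + s.1, 3 * P.2 + s.2)) (rep (3 * P.1 + t.1, 3 * P.2 + t.2)))
        (fun _ _ => hs _ _) (fun _ _ _ => ht _ _ _) (e P) ?_ ?_ hs' ht'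
      · intro b hb
        have hg : ∀ a, ¬ BadBlock good n (3 * P.1 + (a : Fin 3), 3 * P.2 + b) := fun a =>
          he P hP (a, b) fun h => hb (congrArg Prod.snd h)
        exact ⟨hh (3 * P.1, 3 * P.2 + b) (hg 0) (hg 1), hh (3 * P.1 + 1, 3 * P.2 + b) (hg 1) (hg 2)⟩
      · intro a ha
        have hg : ∀ b, ¬ BadBlock good n (3 * P.1 + a, 3 * P.2 + (b : Fin 3)) := fun b =>
          he P hP (a, b) fun h => ha (congrArg Prod.fst h)
        exact ⟨hv (3 * P.1 + a, 3 * P.2) (hg 0) (hg 1), hv (3 * P.1 + a, 3 * P.2 + 1) (hg 1) (hg 2)⟩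
    refine ⟨fun P => rep (3 * P.1 + (h P).1, 3 * P.2 + (h P).2), fun P => ?_, fun P hP hP' => ?_,
      fun P hP hP' => ?_⟩
    · obtain ⟨k1, k2, k3, k4⟩ := hrep (3 * P.1 + (h P).1, 3 * P.2 + (h P).2)
      have l1 : ((h P).1 : ℕ) + 1 ≤ 3 := (h P).1.2
      have l2 : ((h P).2 : ℕ) + 1 ≤ 3 := (h P).2.2
      simp only at k1 k2 k3 k4 ⊢
      have e1 : 3 ^ (n + 1) = 3 ^ n * 3 := pow_succ 3 n
      refine ⟨le_trans ?_ k1, k2.trans_le ?_, le_trans ?_ k3, k4.trans_le ?_⟩ <;>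
      · rw [e1, mul_assoc]
        exact Nat.mul_le_mul_left _ (by omega)
    · obtain ⟨b, hb, hb'⟩ := exists_ne_ne_fin_three (e P).2 (e (P.1 + 1, P.2)).2
      have k1 := hin P hP (h P) (2, b) (hhub P) (fun h => hb (congrArg Prod.snd h))
      have k2 := hin _ hP' (0, b) (h (P.1 + 1, P.2)) (fun h => hb' (congrArg Prod.snd h)) (hhub _)
      refine ht _ _ _ k1 (ht _ _ _ ?_ k2)
      exact hh (3 * P.1 + 2, 3 * P.2 + b) (he P hP (2, b) (fun h => hb (congrArg Prod.snd h)))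
        (he _ hP' (0, b) (fun h => hb' (congrArg Prod.snd h)))
    · obtain ⟨a, ha, ha'⟩ := exists_ne_ne_fin_three (e P).1 (e (P.1, P.2 + 1)).1
      have k1 := hin P hP (h P) (a, 2) (hhub P) (fun h => ha (congrArg Prod.fst h))
      have k2 := hin _ hP' (a, 0) (h (P.1, P.2 + 1)) (fun h => ha' (congrArg Prod.fst h)) (hhub _)
      refine ht _ _ _ k1 (ht _ _ _ ?_ k2)
      exact hv (3 * P.1 + a, 3 * P.2 + 2) (he P hP (a, 2) (fun h => ha (congrArg Prod.fst h)))
        (he _ hP' (a, 0) (fun h => ha' (congrArg Prod.fst h)))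

end HierarchicalBlocks

/-! ### Finiteness of the critical parameter -/

section Supercritical

variable {d : ℕ} (i₀ i₁ : Fin d) (δ R : ℝ)

/-- The centers of the cells of a two-dimensional grid with mesh `δ` in `ℝ^d`. -/
noncomputable def cellCenter (p : ℕ × ℕ) : EuclideanSpace ℝ (Fin d) :=
  EuclideanSpace.single i₀ ((p.1 + 1 / 2) * δ) + EuclideanSpace.single i₁ ((p.2 + 1 / 2) * δ)

/-- The points with center in the cell `p` and radius larger than `R`. -/
noncomputable def cellPoints (p : ℕ × ℕ) : Set (EuclideanSpace ℝ (Fin d) × ℝ) :=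
  Metric.ball (cellCenter i₀ i₁ δ p) (δ / 2) ×ˢ Ioi R

/-- The points whose center has its coordinates `i₀` and `i₁` in the block of level `n` at `P`. -/
def blockRegion (n : ℕ) (P : ℕ × ℕ) : Set (EuclideanSpace ℝ (Fin d) × ℝ) :=
  {z | z.1 i₀ ∈ Ico (3 ^ n * P.1 * δ) (3 ^ n * (P.1 + 1) * δ) ∧
    z.1 i₁ ∈ Ico (3 ^ n * P.2 * δ) (3 ^ n * (P.2 + 1) * δ)}

variable {i₀ i₁ δ R}

theorem measurableSet_cellPoints (p : ℕ × ℕ) : MeasurableSet (cellPoints i₀ i₁ δ R p) :=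
  Metric.isOpen_ball.measurableSet.prod measurableSet_Ioi

theorem cellPoints_subset_blockRegion (hi : i₀ ≠ i₁) (p : ℕ × ℕ) :
    cellPoints i₀ i₁ δ R p ⊆ blockRegion i₀ i₁ δ 0 p := by
  rintro ⟨x, r⟩ ⟨hx, -⟩
  rw [Metric.mem_ball, dist_eq_norm] at hx
  have h0 := (PiLp.norm_apply_le (x - cellCenter i₀ i₁ δ p) i₀).trans_lt hx
  have h1 := (PiLp.norm_apply_le (x - cellCenter i₀ i₁ δ p) i₁).trans_lt hx
  simp only [cellCenter, PiLp.sub_apply, PiLp.add_apply, PiLp.single_apply, hi, hi.symm,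
    if_true, if_false, Real.norm_eq_abs, add_zero, zero_add, abs_lt] at h0 h1
  simp only [blockRegion, mem_ofPred_eq, mem_Ico, pow_zero, one_mul]
  refine ⟨⟨?_, ?_⟩, ?_, ?_⟩ <;> linarith

theorem blockRegion_disjoint (hδ : 0 < δ) (n : ℕ) {P P' : ℕ × ℕ} (h : P ≠ P') :
    Disjoint (blockRegion i₀ i₁ δ n P) (blockRegion i₀ i₁ δ n P') := by
  have key : ∀ (a b : ℕ) (x : ℝ), x ∈ Ico (3 ^ n * a * δ) (3 ^ n * (a + 1) * δ) →
      x ∈ Ico (3 ^ n * b * δ) (3 ^ n * (b + 1) * δ) → a ≤ b := by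
    intro a b x ha hb
    have h1 : (3 : ℝ) ^ n * a * δ < 3 ^ n * (b + 1) * δ := ha.1.trans_lt hb.2
    have h2 := lt_of_mul_lt_mul_left (lt_of_mul_lt_mul_right h1 hδ.le) (by positivity)
    have h3 : a < b + 1 := by exact_mod_cast h2
    omega
  rw [Set.disjoint_left]
  intro z hz hz'
  exact h (Prod.ext (le_antisymm (key _ _ _ hz.1 hz'.1) (key _ _ _ hz'.1 hz.1))
    (le_antisymm (key _ _ _ hz.2 hz'.2) (key _ _ _ hz'.2 hz.2)))

theorem blockRegion_subset_succ (hδ : 0 < δ) (n : ℕ) (P : ℕ × ℕ) (s : Fin 3 × Fin 3) :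
    blockRegion i₀ i₁ δ n (3 * P.1 + s.1, 3 * P.2 + s.2) ⊆ blockRegion i₀ i₁ δ (n + 1) P := by
  have key : ∀ (a : ℕ) (s : Fin 3) (x : ℝ),
      x ∈ Ico (3 ^ n * ((3 * a + s : ℕ) : ℝ) * δ) (3 ^ n * (((3 * a + s : ℕ) : ℝ) + 1) * δ) →
      x ∈ Ico (3 ^ (n + 1) * (a : ℝ) * δ) (3 ^ (n + 1) * ((a : ℝ) + 1) * δ) := by
    intro a s x hx
    have hs : ((s : ℕ) : ℝ) + 1 ≤ 3 := by exact_mod_cast s.2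
    have hs0 : (0 : ℝ) ≤ ((s : ℕ) : ℝ) := Nat.cast_nonneg _
    push_cast at hx
    have e1 : (3 : ℝ) ^ (n + 1) * a * δ = 3 ^ n * (3 * a) * δ := by ring
    have e2 : (3 : ℝ) ^ (n + 1) * (a + 1) * δ = 3 ^ n * (3 * a + 3) * δ := by ring
    rw [e1, e2]
    refine ⟨le_trans ?_ hx.1, hx.2.trans_le ?_⟩
    · exact mul_le_mul_of_nonneg_right
        (mul_le_mul_of_nonneg_left (by linarith) (by positivity)) hδ.le
    · exact mul_le_mul_of_nonneg_right
        (mul_le_mul_of_nonneg_left (by linarith) (by positivity)) hδ.le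
  intro z hz
  exact ⟨key _ _ _ hz.1, key _ _ _ hz.2⟩

variable (i₀ i₁ δ R) in
/-- The cell `p` contains the center of a ball of radius larger than `R`. -/
def GoodCell (m : Measure (EuclideanSpace ℝ (Fin d) × ℝ)) (p : ℕ × ℕ) : Prop :=
  m (cellPoints i₀ i₁ δ R p) ≠ 0

theorem measurableSet_badBlock (hi : i₀ ≠ i₁) (hδ : 0 < δ) (n : ℕ) (P : ℕ × ℕ) :
    MeasurableSet[voidSigma (blockRegion i₀ i₁ δ n P)]
      {m | BadBlock (GoodCell i₀ i₁ δ R m) n P} := by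
  induction n generalizing P with
  | zero =>
    refine MeasurableSpace.measurableSet_generateFrom ⟨cellPoints i₀ i₁ δ R P,
      measurableSet_cellPoints P, cellPoints_subset_blockRegion hi P, ?_⟩
    ext m
    simp [BadBlock, GoodCell]
  | succ n ih =>
    have : {m | BadBlock (GoodCell i₀ i₁ δ R m) (n + 1) P} =
        ⋃ (s : Fin 3 × Fin 3) (t : Fin 3 × Fin 3) (_ : s ≠ t),
          {m | BadBlock (GoodCell i₀ i₁ δ R m) n (3 * P.1 + s.1, 3 * P.2 + s.2)} ∩
          {m | BadBlock (GoodCell i₀ i₁ δ R m) n (3 * P.1 + t.1, 3 * P.2 + t.2)} := by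
      ext m
      simp only [BadBlock, mem_iUnion, mem_inter_iff, mem_ofPred_eq, exists_prop]
    rw [this]
    have hm : ∀ s : Fin 3 × Fin 3, MeasurableSet[voidSigma (blockRegion i₀ i₁ δ (n + 1) P)]
        {m | BadBlock (GoodCell i₀ i₁ δ R m) n (3 * P.1 + s.1, 3 * P.2 + s.2)} := fun s =>
      voidSigma_mono (blockRegion_subset_succ hδ n P s) _ (ih _)
    refine MeasurableSet.iUnion fun s => MeasurableSet.iUnion fun t => MeasurableSet.iUnion fun _ => ?_
    exact (hm s).inter (hm t)

/-- There are at most `9 * 9 = 81` ordered pairs of distinct subblocks, and these are bad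
independently because their regions are disjoint. Hence `p (n + 1) ≤ 81 * p n ^ 2`, which the
normalization `81 * p n` turns into pure squaring. -/
theorem measure_badBlock_le {Q : Measure (Measure (EuclideanSpace ℝ (Fin d) × ℝ))}
    {Λ : Measure (EuclideanSpace ℝ (Fin d) × ℝ)} (hQ : IsVoidLaw Q Λ) (hi : i₀ ≠ i₁)
    (hδ : 0 < δ) {q : ℝ≥0∞} (hq : ∀ p, expNeg (Λ (cellPoints i₀ i₁ δ R p)) ≤ q) (n : ℕ)
    (P : ℕ × ℕ) : 81 * Q {m | BadBlock (GoodCell i₀ i₁ δ R m) n P} ≤ (81 * q) ^ (2 ^ n) := by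
  induction n generalizing P with
  | zero =>
    simp only [pow_zero, pow_one]
    gcongr
    refine le_trans (le_of_eq ?_) (hq P)
    rw [← hQ.void _ (measurableSet_cellPoints P)]
    congr 1
    ext m
    simp [BadBlock, GoodCell]
  | succ n ih =>
    set B : Fin 3 × Fin 3 → Set (Measure (EuclideanSpace ℝ (Fin d) × ℝ)) := fun s =>
      {m | BadBlock (GoodCell i₀ i₁ δ R m) n (3 * P.1 + s.1, 3 * P.2 + s.2)} with hB
    have hsub : {m | BadBlock (GoodCell i₀ i₁ δ R m) (n + 1) P} ⊆
        ⋃ p ∈ (Finset.univ : Finset ((Fin 3 × Fin 3) × (Fin 3 × Fin 3))).filter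
          (fun p => p.1 ≠ p.2), B p.1 ∩ B p.2 := by
      rintro m ⟨s, t, hst, hs, ht⟩
      simp only [mem_iUnion]
      exact ⟨(s, t), by simp [hst], hs, ht⟩
    have hind : ∀ s t, s ≠ t → Q (B s ∩ B t) = Q (B s) * Q (B t) := by
      intro s t hst
      refine hQ.inter (blockRegion_disjoint (i₀ := i₀) (i₁ := i₁) hδ n ?_)
        (measurableSet_badBlock hi hδ n _) (measurableSet_badBlock hi hδ n _)
      intro h
      apply hst
      have e1 := congrArg Prod.fst h
      have e2 := congrArg Prod.snd h
      simp only at e1 e2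
      exact Prod.ext (Fin.ext (by omega)) (Fin.ext (by omega))
    have hb : ∀ p ∈ (Finset.univ : Finset ((Fin 3 × Fin 3) × (Fin 3 × Fin 3))).filter
        (fun p => p.1 ≠ p.2), 81 * (81 * Q (B p.1 ∩ B p.2)) ≤ (81 * q) ^ (2 ^ (n + 1)) := by
      intro p hp
      rw [hind _ _ (Finset.mem_filter.1 hp).2, pow_succ 2, pow_mul, sq]
      calc 81 * (81 * (Q (B p.1) * Q (B p.2))) = (81 * Q (B p.1)) * (81 * Q (B p.2)) := by ring
        _ ≤ _ := mul_le_mul' (ih _) (ih _)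
    have h81 : (81 : ℝ≥0∞) ≠ 0 := by norm_num
    have h81' : (81 : ℝ≥0∞) ≠ ∞ := by norm_num
    have h3 : 81 * (81 * Q {m | BadBlock (GoodCell i₀ i₁ δ R m) (n + 1) P}) ≤
        81 * (81 * q) ^ (2 ^ (n + 1)) := by
      calc _ ≤ 81 * (81 * ∑ p ∈ (Finset.univ : Finset ((Fin 3 × Fin 3) × (Fin 3 × Fin 3))).filter
              (fun p => p.1 ≠ p.2), Q (B p.1 ∩ B p.2)) := by
            gcongr
            exact (measure_mono hsub).trans (measure_biUnion_finset_le _ _)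
        _ = ∑ p ∈ (Finset.univ : Finset ((Fin 3 × Fin 3) × (Fin 3 × Fin 3))).filter
              (fun p => p.1 ≠ p.2), 81 * (81 * Q (B p.1 ∩ B p.2)) := by
            rw [Finset.mul_sum, Finset.mul_sum]
        _ ≤ _ := Finset.sum_le_card_nsmul _ _ _ hb
        _ ≤ _ := by
            rw [nsmul_eq_mul]
            gcongr
            have : ((Finset.univ : Finset ((Fin 3 × Fin 3) × (Fin 3 × Fin 3))).filter
              (fun p => p.1 ≠ p.2)).card ≤ 81 := (Finset.card_filter_le _ _).trans (by simp)
            exact_mod_cast this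
    exact (ENNReal.mul_le_mul_iff_right h81 h81').1 h3

/-- A ball centered within `δ / 2` of the cell center, of radius larger than `2 δ`, covers the
closed ball of radius `δ` around that center, which reaches the centers of the adjacent cells. -/
theorem joinedIn_cellCenter {m : Measure (EuclideanSpace ℝ (Fin d) × ℝ)} {p : ℕ × ℕ}
    (hR : 2 * δ ≤ R) (hp : GoodCell i₀ i₁ δ R m p) {y : EuclideanSpace ℝ (Fin d)}
    (hy : dist y (cellCenter i₀ i₁ δ p) ≤ δ) :
    JoinedIn (coveredSet m) (cellCenter i₀ i₁ δ p) y := by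
  have hδ : 0 ≤ δ := dist_nonneg.trans hy
  have hsub : Metric.closedBall (cellCenter i₀ i₁ δ p) δ ⊆ coveredSet m := by
    intro x hx h0
    refine hp (measure_mono_null ?_ h0)
    rintro ⟨c, r⟩ ⟨hc, hr⟩
    simp only [mem_Ioi, Metric.mem_ball, Metric.mem_closedBall, mem_ofPred_eq] at *
    have := dist_triangle_right x c (cellCenter i₀ i₁ δ p)
    linarith
  refine JoinedIn.mono ?_ hsub
  exact ((convex_closedBall _ _).isPathConnected ⟨_, Metric.mem_closedBall_self hδ⟩).joinedIn _
    (Metric.mem_closedBall_self hδ) _ hy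

theorem norm_cellCenter_le (δ : ℝ) (hδ : 0 ≤ δ) (p : ℕ × ℕ) :
    ‖cellCenter i₀ i₁ δ p‖ ≤ (p.1 + 1 / 2) * δ + (p.2 + 1 / 2) * δ := by
  refine (norm_add_le _ _).trans (le_of_eq ?_)
  rw [PiLp.norm_single, PiLp.norm_single, Real.norm_of_nonneg (by positivity),
    Real.norm_of_nonneg (by positivity)]

theorem le_norm_cellCenter (hi : i₀ ≠ i₁) (p : ℕ × ℕ) :
    (p.1 + 1 / 2) * δ ≤ ‖cellCenter i₀ i₁ δ p‖ := by
  have h0 := PiLp.norm_apply_le (cellCenter i₀ i₁ δ p) i₀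
  simp only [cellCenter, PiLp.add_apply, PiLp.single_apply, hi, if_true, if_false,
    add_zero] at h0 ⊢
  exact (le_abs_self _).trans h0

theorem mem_crossEvent_of_not_badBlock {m : Measure (EuclideanSpace ℝ (Fin d) × ℝ)}
    (hi : i₀ ≠ i₁) (hδ : 0 < δ) (hR : 2 * δ ≤ R) (n : ℕ)
    (h : ∀ k < 6, ¬ BadBlock (GoodCell i₀ i₁ δ R m) n (k, 0)) :
    m ∈ crossEvent 0 (4 * 3 ^ n * δ) := by
  obtain ⟨rep, hrep, hh, -⟩ := exists_block_representatives
    (good := GoodCell i₀ i₁ δ R m)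
    (J := fun p q => JoinedIn (coveredSet m) (cellCenter i₀ i₁ δ p) (cellCenter i₀ i₁ δ q))
    (fun _ _ h => h.symm) (fun _ _ _ h h' => h.trans h')
    (fun p hp _ => joinedIn_cellCenter hR hp (le_of_eq (by
      rw [dist_eq_norm]
      have : cellCenter i₀ i₁ δ (p.1 + 1, p.2) - cellCenter i₀ i₁ δ p =
          EuclideanSpace.single i₀ δ := by
        ext j
        simp only [cellCenter, PiLp.sub_apply, PiLp.add_apply, PiLp.single_apply]
        push_cast
        split_ifs <;> ring
      rw [this, PiLp.norm_single, Real.norm_of_nonneg hδ.le])))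
    (fun p hp _ => joinedIn_cellCenter hR hp (le_of_eq (by
      rw [dist_eq_norm]
      have : cellCenter i₀ i₁ δ (p.1, p.2 + 1) - cellCenter i₀ i₁ δ p =
          EuclideanSpace.single i₁ δ := by
        ext j
        simp only [cellCenter, PiLp.sub_apply, PiLp.add_apply, PiLp.single_apply]
        push_cast
        split_ifs <;> ring
      rw [this, PiLp.norm_single, Real.norm_of_nonneg hδ.le]))) n
  have hj : ∀ k < 5, JoinedIn (coveredSet m) (cellCenter i₀ i₁ δ (rep (0, 0)))
      (cellCenter i₀ i₁ δ (rep (k + 1, 0))) := by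
    intro k hk
    induction k with
    | zero => exact hh (0, 0) (h 0 (by norm_num)) (h 1 (by norm_num))
    | succ k ih =>
      exact (ih (by omega)).trans (hh (k + 1, 0) (h _ (by omega)) (h _ (by omega)))
  have h5 := hj 4 (by norm_num)
  obtain ⟨-, a1, -, a2⟩ := hrep (0, 0)
  obtain ⟨b1, -, -, -⟩ := hrep (4 + 1, 0)
  -- With `L = 3 ^ n * δ`, the representative of block `0` has norm at most `2 L`, one `L` per
  -- coordinate, and that of block `5` has norm at least `5 L`; the path thus crosses from `S(2 L)`
  -- to `S(4 L)`.
  refine JoinedIn.pathConnects_sphere h5 ?_ ?_ ?_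
  · have : 0 ≤ 4 * 3 ^ n * δ := by positivity
    linarith
  · rw [dist_zero_right]
    refine (norm_cellCenter_le δ hδ.le _).trans ?_
    have c1 : ((rep (0, 0)).1 : ℝ) + 1 ≤ 3 ^ n := by
      have : (rep (0, 0)).1 + 1 ≤ 3 ^ n := by simpa using a1
      exact_mod_cast this
    have c2 : ((rep (0, 0)).2 : ℝ) + 1 ≤ 3 ^ n := by
      have : (rep (0, 0)).2 + 1 ≤ 3 ^ n := by simpa using a2
      exact_mod_cast this
    nlinarith
  · rw [dist_zero_right]
    refine le_trans ?_ (le_norm_cellCenter hi _)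
    have c1 : (3 : ℝ) ^ n * 5 ≤ (rep (4 + 1, 0)).1 := by exact_mod_cast b1
    have : (0 : ℝ) ≤ 3 ^ n := by positivity
    gcongr
    linarith

theorem lambdaHat_ne_top (d : ℕ) (hd : 2 ≤ d) (ν : Measure ℝ) [IsFiniteMeasure ν]
    (hν : ν (Iic 0) = 0) (hpos : ν ≠ 0) : lambdaHat d ν ≠ ∞ := by
  obtain ⟨R, hR, hw⟩ : ∃ R : ℝ, 0 < R ∧ ν (Ioi R) ≠ 0 := by
    by_contra! hc
    refine hpos (Measure.measure_univ_eq_zero.1 ?_)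
    have e : (univ : Set ℝ) = Iic 0 ∪ ⋃ n : ℕ, Ioi (1 / ((n : ℝ) + 1)) := by
      ext x
      simp only [mem_univ, mem_union, mem_Iic, mem_iUnion, mem_Ioi, true_iff]
      by_cases hx : x ≤ 0
      · exact Or.inl hx
      · exact Or.inr (exists_nat_one_div_lt (not_le.1 hx))
    rw [e]
    refine measure_union_null hν (measure_iUnion_null fun n => hc _ (by positivity))
  set i₀ : Fin d := ⟨0, by omega⟩ with hi₀
  set i₁ : Fin d := ⟨1, by omega⟩ with hi₁
  have hi : i₀ ≠ i₁ := by simp [hi₀, hi₁]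
  set δ := R / 2 with hδ
  have hδ0 : 0 < δ := by positivity
  set V := (volume : Measure (EuclideanSpace ℝ (Fin d))) (Metric.ball 0 (δ / 2)) with hV
  have hV0 : V ≠ 0 := (Metric.measure_ball_pos _ _ (by positivity)).ne'
  have hcell : ∀ (l : ℝ≥0) (p : ℕ × ℕ), boolIntensity d (l • ν) (cellPoints i₀ i₁ δ R p) =
      l * (V * ν (Ioi R)) := by
    intro l p
    rw [cellPoints, boolIntensity, Measure.prod_prod, Measure.addHaar_ball_center]
    rw [Measure.smul_apply, ENNReal.smul_def, smul_eq_mul]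
    ring
  -- At intensity `l₀` an empty cell is so rare that the squaring recursion for bad blocks
  -- contracts. Crossings then have probability tending to `1` along the scales `4 * 3 ^ n * δ`.
  obtain ⟨l₀, hl₀⟩ : ∃ l₀ : ℝ≥0, 81 * expNeg (l₀ * (V * ν (Ioi R))) ≤ 1 / 2 := by
    have hc : V * ν (Ioi R) ≠ 0 := mul_ne_zero hV0 hw
    have ht : Tendsto (fun n : ℕ => ((n : ℝ≥0) : ℝ≥0∞) * (V * ν (Ioi R))) atTop (𝓝 ∞) := by
      have := ENNReal.Tendsto.mul_const (b := V * ν (Ioi R)) ENNReal.tendsto_nat_nhds_top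
        (Or.inl ENNReal.top_ne_zero)
      rw [ENNReal.top_mul hc] at this
      simpa using this
    have h2 := ENNReal.Tendsto.const_mul (a := 81) (tendsto_expNeg_top.comp ht)
      (Or.inr (by norm_num))
    rw [mul_zero] at h2
    obtain ⟨n, hn⟩ := (h2.eventually (ge_mem_nhds (show (0 : ℝ≥0∞) < 1 / 2 by simp))).exists
    exact ⟨n, hn⟩
  refine ne_top_of_le_ne_top (ENNReal.coe_ne_top (r := l₀)) (lambdaHat_le fun l hl => ?_)
  by_contra! hlt
  have hl' := crossingVanishes_smul_of_le (ENNReal.coe_le_coe.1 hlt.le) hl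
  rw [crossingVanishes_iff] at hl'
  have hQ := isVoidLaw_voidLaw (boolIntensity d (l₀ • ν))
  have hprob := hQ.prob
  set Q := voidLaw (boolIntensity d (l₀ • ν)) with hQdef
  have hbad : ∀ n P, Q {m | BadBlock (GoodCell i₀ i₁ δ R m) n P} ≤ (1 / 2) ^ (2 ^ n) := by
    intro n P
    refine le_trans ?_ ((measure_badBlock_le hQ hi hδ0 (fun p => by rw [hcell]) n P).trans
      (pow_le_pow_left' hl₀ _))
    exact le_mul_of_one_le_left zero_le (by norm_num)
  have hone : ∀ n : ℕ, 1 ≤ crossProb d (l₀ • ν) (4 * 3 ^ n * δ) + 6 * (1 / 2) ^ (2 ^ n) := by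
    intro n
    calc (1 : ℝ≥0∞) = Q univ := by simp
      _ ≤ Q (crossEvent 0 (4 * 3 ^ n * δ) ∪ ⋃ k ∈ Finset.range 6,
          {m | BadBlock (GoodCell i₀ i₁ δ R m) n (k, 0)}) := by
        refine measure_mono fun m _ => ?_
        by_cases hm : ∀ k < 6, ¬ BadBlock (GoodCell i₀ i₁ δ R m) n (k, 0)
        · exact Or.inl (mem_crossEvent_of_not_badBlock hi hδ0 (by rw [hδ]; linarith) n hm)
        · push Not at hm
          obtain ⟨k, hk, hb⟩ := hm
          refine Or.inr ?_
          simp only [mem_iUnion]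
          exact ⟨k, Finset.mem_range.2 hk, hb⟩
      _ ≤ _ := measure_union_le _ _
      _ ≤ _ := by
        refine add_le_add le_rfl ((measure_biUnion_finset_le _ _).trans ?_)
        refine (Finset.sum_le_card_nsmul _ _ _ fun k _ => hbad n (k, 0)).trans (le_of_eq ?_)
        simp
  have ht1 : Tendsto (fun n : ℕ => (4 : ℝ) * 3 ^ n * δ) atTop atTop := by
    have := (tendsto_pow_atTop_atTop_of_one_lt (show (1 : ℝ) < 3 by norm_num))
    exact (this.const_mul_atTop (by norm_num)).atTop_mul_const hδ0
  have ht2 : Tendsto (fun n : ℕ => (6 : ℝ≥0∞) * (1 / 2) ^ (2 ^ n)) atTop (𝓝 (6 * 0)) := by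
    refine ENNReal.Tendsto.const_mul ?_ (Or.inr (by norm_num))
    have h1 := ENNReal.tendsto_pow_atTop_nhds_zero_of_lt_one
      (show (1 / 2 : ℝ≥0∞) < 1 by
        rw [one_div]; exact ENNReal.inv_lt_one.2 (by norm_num))
    exact h1.comp (tendsto_pow_atTop_atTop_of_one_lt (by norm_num))
  have := (hl'.comp ht1).add ht2
  rw [mul_zero, add_zero] at this
  have := ge_of_tendsto' this hone
  simp at this

end Supercritical

/-! ### Moments of order `d` of the radii -/

section Moments

/-- The contribution of the radii larger than `R` to the moment of order `d`. -/
noncomputable def momentTail (d : ℕ) (μ : Measure ℝ) (R : ℝ) : ℝ≥0∞ :=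
  ∫⁻ r in Ici R, ENNReal.ofReal r ^ d ∂μ

theorem momentTail_add (d : ℕ) (μ μ' : Measure ℝ) (R : ℝ) :
    momentTail d (μ + μ') R = momentTail d μ R + momentTail d μ' R := by
  rw [momentTail, Measure.restrict_add, lintegral_add_measure]; rfl

theorem momentTail_antitone (d : ℕ) (μ : Measure ℝ) : Antitone (momentTail d μ) :=
  fun _ _ h => lintegral_mono_set (Ici_subset_Ici.2 h)

/-- The `d`-th moment is scale invariant, and scaling only moves the start of the tail to `ρ * R`.
For `ρ ≥ 1` the tails are therefore bounded uniformly in `ρ`. -/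
theorem momentTail_scaleMeasure (d : ℕ) {ρ : ℝ} (hρ : 0 < ρ) (μ : Measure ℝ) (R : ℝ) :
    momentTail d (scaleMeasure d ρ μ) R = momentTail d μ (ρ * R) := by
  have hm : Measurable fun r : ℝ => ENNReal.ofReal r ^ d := by fun_prop
  have hd : Measurable fun r : ℝ => r / ρ := by fun_prop
  rw [momentTail, scaleMeasure, Measure.restrict_smul, lintegral_smul_measure,
    setLIntegral_map measurableSet_Ici hm hd, smul_eq_mul,
    ← lintegral_const_mul _ (show Measurable fun r : ℝ => ENNReal.ofReal (r / ρ) ^ d from hm.comp hd)]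
  have e : (fun r : ℝ => r / ρ) ⁻¹' Ici R = Ici (ρ * R) := by
    ext r
    simp only [mem_preimage, mem_Ici]
    rw [le_div_iff₀ hρ, mul_comm]
  rw [e, momentTail]
  refine lintegral_congr fun r => ?_
  rw [← mul_pow, ← ENNReal.ofReal_mul hρ.le, mul_div_cancel₀ _ hρ.ne']

theorem tendsto_momentTail {d : ℕ} {μ : Measure ℝ} [IsFiniteMeasure μ]
    (h : ∫⁻ r, ENNReal.ofReal r ^ d ∂μ ≠ ∞) : Tendsto (momentTail d μ) atTop (𝓝 0) := by
  refine tendsto_setLIntegral_zero h ?_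
  have := tendsto_measure_iInter_atTop (μ := μ) (s := fun R : ℝ => Ici R)
    (fun R => measurableSet_Ici.nullMeasurableSet) (fun _ _ h => Ici_subset_Ici.2 h)
    ⟨0, measure_ne_top _ _⟩
  have e : ⋂ R : ℝ, Ici R = ∅ := by
    refine eq_empty_of_forall_notMem fun x hx => ?_
    have := mem_iInter.1 hx (x + 1)
    simp at this
    linarith
  rwa [e, measure_empty] at this

/-- Beyond `2 R` one has `r ≤ 2 (r - R)`. Consequently an infinite moment stays infinite after
shifting the radii by `R`. -/
theorem lintegral_pow_le_shift (d : ℕ) (μ : Measure ℝ) (R : ℝ) :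
    ∫⁻ r, ENNReal.ofReal r ^ d ∂μ ≤ ENNReal.ofReal (2 * R) ^ d * μ univ +
      2 ^ d * ∫⁻ r, ENNReal.ofReal (r - R) ^ d ∂μ := by
  have hm : Measurable fun r : ℝ => ENNReal.ofReal (r - R) ^ d := by fun_prop
  rw [← lintegral_const, ← lintegral_const_mul _ hm, ← lintegral_add_left measurable_const]
  refine lintegral_mono fun r => ?_
  by_cases hr : r ≤ 2 * R
  · exact le_add_right (pow_le_pow_left' (ENNReal.ofReal_le_ofReal hr) d)
  · refine le_add_left ?_
    rw [← mul_pow]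
    refine pow_le_pow_left' ?_ d
    have : (2 : ℝ≥0∞) = ENNReal.ofReal 2 := by simp
    rw [this, ← ENNReal.ofReal_mul (by norm_num)]
    exact ENNReal.ofReal_le_ofReal (by linarith)

theorem volume_ball_eq {d : ℕ} (hd : 0 < d) (x : EuclideanSpace ℝ (Fin d)) (r : ℝ) :
    volume (Metric.ball x r) =
      ENNReal.ofReal r ^ d * volume (Metric.ball (0 : EuclideanSpace ℝ (Fin d)) 1) := by
  have : Nonempty (Fin d) := ⟨⟨0, hd⟩⟩
  rw [EuclideanSpace.volume_ball, EuclideanSpace.volume_ball]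
  simp

theorem measurableSet_norm_lt {d : ℕ} (a : ℝ) :
    MeasurableSet {z : EuclideanSpace ℝ (Fin d) × ℝ | ‖z.1‖ < a + z.2} :=
  measurableSet_lt (by fun_prop) (by fun_prop)

theorem boolIntensity_norm_lt {d : ℕ} (hd : 0 < d) (μ : Measure ℝ) [IsFiniteMeasure μ] (a : ℝ) :
    boolIntensity d μ {z | ‖z.1‖ < a + z.2} =
      (∫⁻ r, ENNReal.ofReal (a + r) ^ d ∂μ) *
        volume (Metric.ball (0 : EuclideanSpace ℝ (Fin d)) 1) := by
  rw [boolIntensity, Measure.prod_apply_symm (measurableSet_norm_lt a),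
    ← lintegral_mul_const _ (by fun_prop)]
  refine lintegral_congr fun r => ?_
  rw [← volume_ball_eq hd 0]
  congr 1
  ext x
  simp

/-- With an infinite moment, the set of balls containing `B(0, R)` has infinite intensity for every
`R ≥ 0`, so almost surely one such ball exists and produces a crossing. -/
theorem CrossingVanishes.lintegral_ne_top {d : ℕ} (hd : 0 < d) {μ : Measure ℝ}
    [IsFiniteMeasure μ] (h : CrossingVanishes d μ) : ∫⁻ r, ENNReal.ofReal r ^ d ∂μ ≠ ∞ := by
  intro htop
  have hne : Nonempty (Fin d) := ⟨⟨0, hd⟩⟩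
  rw [crossingVanishes_iff] at h
  have hQ := isVoidLaw_voidLaw (boolIntensity d μ)
  have := hQ.prob
  have hone : ∀ R : ℝ, 0 ≤ R → 1 ≤ crossProb d μ R := by
    intro R hR
    have hinf : ∫⁻ r, ENNReal.ofReal (-R + r) ^ d ∂μ = ∞ := by
      by_contra hc
      have h1 := lintegral_pow_le_shift d μ R
      rw [htop, top_le_iff] at h1
      refine absurd h1 (ENNReal.add_ne_top.2 ⟨?_, ?_⟩)
      · exact ENNReal.mul_ne_top (ENNReal.pow_ne_top ENNReal.ofReal_ne_top) (measure_ne_top _ _)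
      · refine ENNReal.mul_ne_top (ENNReal.pow_ne_top (by norm_num)) ?_
        simpa only [neg_add_eq_sub] using hc
    have hΛ : boolIntensity d μ {z | ‖z.1‖ < -R + z.2} = ∞ := by
      rw [boolIntensity_norm_lt hd, hinf, ENNReal.top_mul]
      exact (Metric.measure_ball_pos _ _ one_pos).ne'
    have hvoid := hQ.void _ (measurableSet_norm_lt (-R))
    rw [hΛ, expNeg_top] at hvoid
    calc (1 : ℝ≥0∞) = voidLaw (boolIntensity d μ) univ := by simp
      _ ≤ voidLaw (boolIntensity d μ) (crossEvent 0 R ∪ {m | m {z | ‖z.1‖ < -R + z.2} = 0}) := by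
        refine measure_mono fun m _ => ?_
        by_cases hm : m {z | ‖z.1‖ < -R + z.2} = 0
        · exact Or.inr hm
        · left
          have hsub : Metric.closedBall 0 R ⊆ coveredSet m := by
            intro x hx h0
            refine hm (measure_mono_null ?_ h0)
            intro z hz
            simp only [mem_ofPred_eq, mem_closedBall_zero_iff] at *
            have := dist_le_norm_add_norm x z.1
            linarith
          obtain ⟨v, hv⟩ := (NormedSpace.sphere_nonempty (E := EuclideanSpace ℝ (Fin d))
            (x := 0) (r := R)).2 hR
          have hj : JoinedIn (Metric.closedBall (0 : EuclideanSpace ℝ (Fin d)) R) 0 v :=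
            ((convex_closedBall _ _).isPathConnected
              ⟨0, Metric.mem_closedBall_self hR⟩).joinedIn _ (Metric.mem_closedBall_self hR) _
              (Metric.sphere_subset_closedBall hv)
          exact (hj.mono hsub).pathConnects_sphere (by linarith) (by rw [dist_self]; linarith)
            (le_of_eq hv.symm)
      _ ≤ crossProb d μ R + 0 := (measure_union_le _ _).trans (add_le_add le_rfl hvoid.le)
      _ = _ := add_zero _
  have := ge_of_tendsto h (eventually_atTop.2 ⟨0, hone⟩)
  simp at this

end Moments

/-! ### Renormalization and the finite-size criterion -/

section Renormalization

/-- The points of radius at least `R` whose ball meets `B(0, 22 R)`. -/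
def largeBalls (d : ℕ) (R : ℝ) : Set (EuclideanSpace ℝ (Fin d) × ℝ) :=
  {z | ‖z.1‖ < 22 * R + z.2} ∩ univ ×ˢ Ici R

theorem measurableSet_largeBalls (d : ℕ) (R : ℝ) : MeasurableSet (largeBalls d R) :=
  (measurableSet_norm_lt _).inter (MeasurableSet.univ.prod measurableSet_Ici)

theorem boolIntensity_largeBalls_le {d : ℕ} (hd : 0 < d) (μ : Measure ℝ) [IsFiniteMeasure μ]
    (R : ℝ) : boolIntensity d μ (largeBalls d R) ≤
      23 ^ d * volume (Metric.ball (0 : EuclideanSpace ℝ (Fin d)) 1) * momentTail d μ R := by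
  have e : boolIntensity d μ (largeBalls d R) =
      boolIntensity d (μ.restrict (Ici R)) {z | ‖z.1‖ < 22 * R + z.2} := by
    rw [boolIntensity, boolIntensity, ← Measure.restrict_univ (μ := volume),
      Measure.prod_restrict, Measure.restrict_apply (measurableSet_norm_lt _), largeBalls,
      Measure.restrict_univ]
  rw [e, boolIntensity_norm_lt hd]
  have h1 : ∫⁻ r in Ici R, ENNReal.ofReal (22 * R + r) ^ d ∂μ ≤ 23 ^ d * momentTail d μ R := by
    rw [momentTail, ← lintegral_const_mul _ (by fun_prop)]
    refine setLIntegral_mono (by fun_prop) fun r hr => ?_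
    rw [← mul_pow]
    refine pow_le_pow_left' ?_ d
    have : (23 : ℝ≥0∞) = ENNReal.ofReal 23 := by simp
    rw [this, ← ENNReal.ofReal_mul (by norm_num)]
    exact ENNReal.ofReal_le_ofReal (by linarith [mem_Ici.1 hr])
  calc _ ≤ 23 ^ d * momentTail d μ R *
        volume (Metric.ball (0 : EuclideanSpace ℝ (Fin d)) 1) := by gcongr
    _ = _ := by ring

/-- Truncate the path to the closed ball `B(x, R)`, which lies within `21 R` of the origin. A ball
of radius at least `R` meeting it would belong to `largeBalls`; a smaller one has its center in
`B(x, 2R)`. -/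
theorem mem_localCrossEvent {d : ℕ} {R : ℝ} (hR : 0 < R)
    {m : Measure (EuclideanSpace ℝ (Fin d) × ℝ)} (hm : m (largeBalls d R) = 0)
    {x : EuclideanSpace ℝ (Fin d)} (hx : ‖x‖ ≤ 20 * R) (h : m ∈ crossEvent x R) :
    m ∈ localCrossEvent x R := by
  refine (PathConnects.truncate_sphere (by linarith) h).mono ?_
  rintro y ⟨hy, hyx⟩ h0
  refine hy ?_
  rw [Measure.restrict_apply (measurableSet_dist_lt y)] at h0
  refine measure_mono_null ?_ (measure_union_null hm h0)
  intro z hz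
  by_cases hz2 : R ≤ z.2
  · left
    refine ⟨?_, mem_univ _, hz2⟩
    simp only [mem_ofPred_eq, Metric.mem_closedBall] at *
    have h1 : ‖z.1‖ ≤ dist y z.1 + dist y x + ‖x‖ := by
      have := dist_triangle4 z.1 y x 0
      rw [dist_zero_right, dist_zero_right, dist_comm z.1 y] at this
      exact this
    linarith
  · right
    refine ⟨hz, ?_, mem_univ _⟩
    simp only [mem_ofPred_eq, Metric.mem_closedBall, Metric.mem_ball] at *
    have := dist_triangle_left z.1 x y
    linarith

theorem mem_crossEvent_of_joinedIn {d : ℕ} {R : ℝ} (hR : 0 < R)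
    {m : Measure (EuclideanSpace ℝ (Fin d) × ℝ)} {u v x : EuclideanSpace ℝ (Fin d)}
    (hj : JoinedIn (coveredSet m) u v) (hu : dist u x ≤ R / 2) (huv : 3 / 2 * R ≤ dist u v) :
    m ∈ crossEvent x R := by
  refine hj.pathConnects_sphere (by linarith) hu ?_
  have := dist_triangle u x v
  rw [dist_comm x v] at this
  linarith

/-- The cover is chosen at scale `1` and dilated, so its cardinality does not depend on `R`. -/
theorem exists_finite_cover (d : ℕ) : ∃ T : Finset (EuclideanSpace ℝ (Fin d)),
    ∀ R : ℝ, 0 < R → ∀ u : EuclideanSpace ℝ (Fin d), ‖u‖ ≤ 20 * R →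
      ∃ t ∈ T, ‖R • t‖ ≤ 20 * R ∧ dist u (R • t) < R / 2 := by
  obtain ⟨t, hts, htf, hcov⟩ := (isCompact_closedBall (0 : EuclideanSpace ℝ (Fin d)) 20).finite_cover_balls
    (show (0 : ℝ) < 1 / 2 by norm_num)
  refine ⟨htf.toFinset, fun R hR u hu => ?_⟩
  have h1 : R⁻¹ • u ∈ Metric.closedBall (0 : EuclideanSpace ℝ (Fin d)) 20 := by
    rw [mem_closedBall_zero_iff, norm_smul, norm_inv, Real.norm_of_nonneg hR.le,
      inv_mul_le_iff₀ hR]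
    linarith
  have h2 := hcov h1
  simp only [mem_iUnion, Metric.mem_ball, exists_prop] at h2
  obtain ⟨y, hy, hd⟩ := h2
  refine ⟨y, htf.mem_toFinset.2 hy, ?_, ?_⟩
  · have := hts hy
    rw [mem_closedBall_zero_iff] at this
    rw [norm_smul, Real.norm_of_nonneg hR.le]
    nlinarith
  · have : u = R • (R⁻¹ • u) := by rw [smul_inv_smul₀ hR.ne']
    rw [this, dist_smul₀, Real.norm_of_nonneg hR.le]
    nlinarith

/-- Absent large balls, a path from `S(5R)` to `S(10R)` makes a local crossing near each end. The
two centers are at distance at least `5R - R/2 - R/2 = 4R`, so the local events use disjoint regions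
and are independent: hence the square. For the second bound, the start of the path alone suffices:
it has norm `r / 2 ≤ 20 R`, and the path travels at least `r / 2 ≥ 3R / 2`. -/
theorem exists_crossProb_bounds {d : ℕ} (hd : 0 < d) : ∃ K C : ℝ≥0, 1 ≤ K ∧
    ∀ μ : Measure ℝ, ∀ _ : IsFiniteMeasure μ, ∀ R : ℝ, 0 < R →
      localCrossProb d μ (10 * R) ≤ K * localCrossProb d μ R ^ 2 + C * momentTail d μ R ∧
      ∀ r ∈ Icc (3 * R) (40 * R),
        crossProb d μ r ≤ K * localCrossProb d μ R + C * momentTail d μ R := by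
  obtain ⟨T, hT⟩ := exists_finite_cover d
  have hV : 23 ^ d * volume (Metric.ball (0 : EuclideanSpace ℝ (Fin d)) 1) ≠ ∞ :=
    ENNReal.mul_ne_top (ENNReal.pow_ne_top (by norm_num)) measure_ball_lt_top.ne
  have hTn : (1 : ℝ≥0) ≤ T.card := by
    obtain ⟨t, ht, -⟩ := hT 1 one_pos 0 (by norm_num)
    exact_mod_cast Finset.card_pos.2 ⟨t, ht⟩
  refine ⟨T.card ^ 2, (23 ^ d * volume (Metric.ball (0 : EuclideanSpace ℝ (Fin d)) 1)).toNNReal,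
    one_le_pow₀ hTn, fun μ _ R hR => ?_⟩
  have hQ := isVoidLaw_voidLaw (boolIntensity d μ)
  have hprob := hQ.prob
  have hlarge : voidLaw (boolIntensity d μ) {m | m (largeBalls d R) ≠ 0} ≤
      ((23 ^ d * volume (Metric.ball (0 : EuclideanSpace ℝ (Fin d)) 1)).toNNReal : ℝ≥0∞) *
        momentTail d μ R := by
    rw [ENNReal.coe_toNNReal hV]
    exact (hQ.measure_ne_zero_le (measurableSet_largeBalls d R)).trans
      (boolIntensity_largeBalls_le hd μ R)
  constructor
  · have hsub : localCrossEvent (0 : EuclideanSpace ℝ (Fin d)) (10 * R) ⊆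
        (⋃ p ∈ (T ×ˢ T).filter (fun p => 4 * R ≤ dist (R • p.1) (R • p.2)),
          localCrossEvent (R • p.1) R ∩ localCrossEvent (R • p.2) R) ∪
        {m | m (largeBalls d R) ≠ 0} := by
      intro m hm
      by_cases hl : m (largeBalls d R) = 0
      swap
      · exact Or.inr hl
      left
      obtain ⟨u, hu, v, hv, hj⟩ := localCrossEvent_subset _ _ hm
      rw [mem_sphere_zero_iff_norm] at hu hv
      obtain ⟨s, hs, hs', hus⟩ := hT R hR u (by linarith)
      obtain ⟨t, ht, ht', hvt⟩ := hT R hR v (by linarith)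
      have huv : 5 * R ≤ dist u v := by
        have := norm_le_norm_add_norm_sub u v
        rw [dist_eq_norm]
        linarith
      have hst : 4 * R ≤ dist (R • s) (R • t) := by
        have := dist_triangle4 u (R • s) (R • t) v
        rw [dist_comm (R • t) v] at this
        linarith
      simp only [mem_iUnion]
      refine ⟨(s, t), by simp [hs, ht, hst], ?_, ?_⟩
      · exact mem_localCrossEvent hR hl hs'
          (mem_crossEvent_of_joinedIn hR hj hus.le (by linarith))
      · exact mem_localCrossEvent hR hl ht'
          (mem_crossEvent_of_joinedIn hR hj.symm hvt.le (by rw [dist_comm]; linarith))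
    refine (measure_mono hsub).trans ((measure_union_le _ _).trans (add_le_add ?_ hlarge))
    refine (measure_biUnion_finset_le _ _).trans ?_
    have hb : ∀ p ∈ (T ×ˢ T).filter (fun p => 4 * R ≤ dist (R • p.1) (R • p.2)),
        voidLaw (boolIntensity d μ) (localCrossEvent (R • p.1) R ∩ localCrossEvent (R • p.2) R) ≤
          localCrossProb d μ R ^ 2 := by
      intro p hp
      have hd := (Finset.mem_filter.1 hp).2
      rw [hQ.inter ?_ (measurableSet_localCrossEvent _ _) (measurableSet_localCrossEvent _ _),
        voidLaw_localCrossEvent, voidLaw_localCrossEvent, sq]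
      rw [Set.disjoint_prod]
      exact Or.inl (Metric.ball_disjoint_ball (by linarith))
    refine (Finset.sum_le_card_nsmul _ _ _ hb).trans ?_
    rw [nsmul_eq_mul]
    gcongr
    have : ((T ×ˢ T).filter (fun p => 4 * R ≤ dist (R • p.1) (R • p.2))).card ≤ T.card ^ 2 := by
      refine (Finset.card_filter_le _ _).trans ?_
      rw [Finset.card_product, sq]
    exact_mod_cast this
  · intro r hr
    have hsub : crossEvent (0 : EuclideanSpace ℝ (Fin d)) r ⊆
        (⋃ t ∈ T, localCrossEvent (R • t) R) ∪ {m | m (largeBalls d R) ≠ 0} := by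
      intro m hm
      by_cases hl : m (largeBalls d R) = 0
      swap
      · exact Or.inr hl
      left
      obtain ⟨u, hu, v, hv, hj⟩ := hm
      rw [mem_sphere_zero_iff_norm] at hu hv
      obtain ⟨s, hs, hs', hus⟩ := hT R hR u (by linarith [hr.2])
      have huv : 3 / 2 * R ≤ dist u v := by
        have := norm_le_norm_add_norm_sub u v
        rw [dist_eq_norm]
        linarith [hr.1]
      simp only [mem_iUnion]
      exact ⟨s, hs, mem_localCrossEvent hR hl hs' (mem_crossEvent_of_joinedIn hR hj hus.le huv)⟩
    refine (measure_mono hsub).trans ((measure_union_le _ _).trans (add_le_add ?_ hlarge))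
    refine (measure_biUnion_finset_le _ _).trans ?_
    have hb : ∀ t ∈ T, voidLaw (boolIntensity d μ) (localCrossEvent (R • t) R) ≤
        localCrossProb d μ R := fun t _ => (voidLaw_localCrossEvent d μ _ R).le
    refine (Finset.sum_le_card_nsmul _ _ _ hb).trans ?_
    rw [nsmul_eq_mul]
    gcongr
    have : (T.card : ℝ≥0) ≤ (T.card : ℝ≥0) ^ 2 := le_self_pow₀ hTn (by norm_num)
    exact_mod_cast this

theorem tendsto_zero_of_le_half {a b : ℕ → ℝ≥0∞} (h0 : a 0 ≠ ∞) (hb : Tendsto b atTop (𝓝 0))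
    (hb' : ∀ n, b n ≠ ∞) (h : ∀ n, a (n + 1) ≤ a n / 2 + b n) : Tendsto a atTop (𝓝 0) := by
  have hfin : ∀ n, a n ≠ ∞ := by
    intro n
    induction n with
    | zero => exact h0
    | succ n ih =>
      exact ne_top_of_le_ne_top (ENNReal.add_ne_top.2 ⟨ENNReal.div_ne_top ih (by norm_num), hb' n⟩)
        (h n)
  rw [ENNReal.tendsto_nhds_zero]
  intro ε hε
  by_cases hε' : ε = ∞
  · simp [hε']
  have hε2 : 0 < ε / 2 := ENNReal.half_pos hε.ne'
  have hε4 : 0 < ε / 2 / 2 := ENNReal.half_pos hε2.ne'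
  obtain ⟨N, hN⟩ := eventually_atTop.1 (ENNReal.tendsto_nhds_zero.1 hb (ε / 2 / 2) hε4)
  have key : ∀ k, a (N + k) ≤ a N * (1 / 2) ^ k + ε / 2 := by
    intro k
    induction k with
    | zero => simp
    | succ k ih =>
      calc a (N + (k + 1)) ≤ a (N + k) / 2 + b (N + k) := h _
        _ ≤ (a N * (1 / 2) ^ k + ε / 2) / 2 + ε / 2 / 2 := by
          gcongr
          exact hN _ (by omega)
        _ = a N * (1 / 2) ^ (k + 1) + (ε / 2 / 2 + ε / 2 / 2) := by
          rw [ENNReal.add_div, pow_succ, ← add_assoc, ← mul_assoc, mul_one_div]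
        _ = _ := by rw [ENNReal.add_halves]
  have ht : Tendsto (fun k : ℕ => a N * (1 / 2) ^ k) atTop (𝓝 (a N * 0)) := by
    refine ENNReal.Tendsto.const_mul ?_ (Or.inr (hfin N))
    exact ENNReal.tendsto_pow_atTop_nhds_zero_of_lt_one
      (by rw [one_div]; exact ENNReal.inv_lt_one.2 (by norm_num))
  rw [mul_zero] at ht
  obtain ⟨M, hM⟩ := eventually_atTop.1 (ENNReal.tendsto_nhds_zero.1 ht (ε / 2) hε2)
  refine eventually_atTop.2 ⟨N + M, fun n hn => ?_⟩
  obtain ⟨k, rfl⟩ := Nat.exists_eq_add_of_le (show N ≤ n by omega)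
  calc a (N + k) ≤ a N * (1 / 2) ^ k + ε / 2 := key k
    _ ≤ ε / 2 + ε / 2 := by gcongr; exact hM k (by omega)
    _ = ε := ENNReal.add_halves ε

/-- The finite-size criterion: if crossings at one scale are unlikely and large balls are rare
from this scale on, then crossings at scale `r` become unlikely as `r` tends to infinity. -/
theorem exists_finite_size_criterion {d : ℕ} (hd : 0 < d) : ∃ η : ℝ≥0∞, 0 < η ∧
    ∀ μ : Measure ℝ, ∀ _ : IsFiniteMeasure μ, ∀ R : ℝ, 0 < R →
      Tendsto (momentTail d μ) atTop (𝓝 0) → momentTail d μ R ≤ η →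
      localCrossProb d μ R ≤ η → CrossingVanishes d μ := by
  obtain ⟨K, C, hK, hKC⟩ := exists_crossProb_bounds hd
  have hK0 : (K : ℝ≥0∞) ≠ 0 := by
    have : K ≠ 0 := (zero_lt_one.trans_le hK).ne'
    exact_mod_cast this
  -- Multiplying by `K` gives `f (n + 1) ≤ f n ^ 2 + b n`. The choice of `η` ensures `f 0 ≤ 1 / 2`
  -- and `b n ≤ 1 / 4`, which keeps `f ≤ 1 / 2`, so that `f n ^ 2 ≤ f n / 2` and `b n → 0` give `f n
  -- → 0`. The `C + 1` keeps the denominator positive.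
  refine ⟨min ((1 / 2) / K) ((1 / 4) / (K * (C + 1))), ?_, fun μ _ R hR ht hR' hloc => ?_⟩
  · refine lt_min (ENNReal.div_pos (by norm_num) ENNReal.coe_ne_top)
      (ENNReal.div_pos (by norm_num) ?_)
    exact ENNReal.mul_ne_top ENNReal.coe_ne_top (by simp)
  set f : ℕ → ℝ≥0∞ := fun n => K * localCrossProb d μ (10 ^ n * R) with hf
  set b : ℕ → ℝ≥0∞ := fun n => K * (C * momentTail d μ (10 ^ n * R)) with hbdef
  have hpos : ∀ n : ℕ, 0 < 10 ^ n * R := fun n => by positivity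
  have hscale : Tendsto (fun n : ℕ => (10 : ℝ) ^ n * R) atTop atTop :=
    (tendsto_pow_atTop_atTop_of_one_lt (by norm_num)).atTop_mul_const hR
  have hb : ∀ n, b n ≤ 1 / 4 := by
    intro n
    have h1 : momentTail d μ (10 ^ n * R) ≤ (1 / 4) / (K * (C + 1)) := by
      refine (momentTail_antitone d μ ?_).trans (hR'.trans (min_le_right _ _))
      have : (1 : ℝ) ≤ 10 ^ n := one_le_pow₀ (by norm_num)
      nlinarith
    calc b n ≤ K * ((C + 1) * ((1 / 4) / (K * (C + 1)))) := by
          simp only [hbdef]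
          gcongr
          exact le_self_add
      _ = (K * (C + 1)) * ((1 / 4) / (K * (C + 1))) := by ring
      _ ≤ 1 / 4 := ENNReal.mul_div_le
  have hb0 : Tendsto b atTop (𝓝 0) := by
    have h1 := ENNReal.Tendsto.const_mul (a := (C : ℝ≥0∞)) (ht.comp hscale)
      (Or.inr ENNReal.coe_ne_top)
    have h2 := ENNReal.Tendsto.const_mul (a := (K : ℝ≥0∞)) h1 (Or.inr ENNReal.coe_ne_top)
    simpa using h2
  have hrec : ∀ n, f (n + 1) ≤ f n ^ 2 + b n := by
    intro n
    have h1 := (hKC μ inferInstance _ (hpos n)).1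
    have e : (10 : ℝ) ^ (n + 1) * R = 10 * (10 ^ n * R) := by ring
    simp only [hf, hbdef, e]
    calc _ ≤ (K : ℝ≥0∞) * (K * localCrossProb d μ (10 ^ n * R) ^ 2 +
          C * momentTail d μ (10 ^ n * R)) := by gcongr
      _ = _ := by ring
  have hf0 : f 0 ≤ 1 / 2 := by
    simp only [hf, pow_zero, one_mul]
    calc _ ≤ (K : ℝ≥0∞) * ((1 / 2) / K) := by
          gcongr
          exact hloc.trans (min_le_left _ _)
      _ ≤ _ := ENNReal.mul_div_le
  have hhalf : ∀ n, f n ≤ 1 / 2 := by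
    intro n
    induction n with
    | zero => exact hf0
    | succ n ih =>
      refine (hrec n).trans ((add_le_add (pow_le_pow_left' ih 2) (hb n)).trans (le_of_eq ?_))
      rw [one_div, one_div, ← ENNReal.inv_pow]
      norm_num
      rw [show (4 : ℝ≥0∞) = 2 * 2 by norm_num, ENNReal.mul_inv (by norm_num) (by norm_num),
        ← mul_add, ENNReal.inv_two_add_inv_two, mul_one]
  have hf_lim : Tendsto f atTop (𝓝 0) := by
    refine tendsto_zero_of_le_half (ne_top_of_le_ne_top (by norm_num) hf0) hb0
      (fun n => ne_top_of_le_ne_top (by norm_num) (hb n)) fun n => (hrec n).trans ?_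
    gcongr
    rw [sq, div_eq_mul_inv, ← one_div]
    gcongr
    exact hhalf n
  have hg : Tendsto (fun n => f n + b n) atTop (𝓝 0) := by simpa using hf_lim.add hb0
  rw [crossingVanishes_iff, ENNReal.tendsto_nhds_zero]
  intro ε hε
  obtain ⟨N, hN⟩ := eventually_atTop.1 (ENNReal.tendsto_nhds_zero.1 hg ε hε)
  refine eventually_atTop.2 ⟨3 * 10 ^ N * R, fun r hr => ?_⟩
  have h10 : (1 : ℝ) ≤ 10 ^ N := one_le_pow₀ (by norm_num)
  -- Every large `r` lies in `[3 R', 30 R')` with `R' = 10 ^ n * R`, within the range of the second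
  -- bound at scale `R'`.
  obtain ⟨n, hn1, hn2⟩ := exists_nat_pow_near (x := r / (3 * R)) (y := (10 : ℝ))
    (by rw [le_div_iff₀ (by positivity)]; nlinarith) (by norm_num)
  rw [le_div_iff₀ (by positivity)] at hn1
  rw [div_lt_iff₀ (by positivity)] at hn2
  have hNn : N ≤ n := by
    have h1 : (10 : ℝ) ^ N * (3 * R) < 10 ^ (n + 1) * (3 * R) := by linarith
    have h2 := lt_of_mul_lt_mul_right h1 (by positivity)
    have h3 := (pow_lt_pow_iff_right₀ (show (1 : ℝ) < 10 by norm_num)).1 h2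
    omega
  refine ((hKC μ inferInstance _ (hpos n)).2 r ⟨by linarith, ?_⟩).trans (le_trans ?_ (hN n hNn))
  · rw [pow_succ] at hn2
    nlinarith [hpos n]
  · simp only [hf, hbdef]
    exact add_le_add le_rfl (le_mul_of_one_le_left zero_le (by exact_mod_cast hK))

end Renormalization

/-! ### Absorbing a small-scale subcritical model -/

section Mixture

/-- The map multiplying all radii by `s`. -/
def dilateRadii {E : Type*} (s : ℝ) : E × ℝ → E × ℝ := Prod.map id (fun r => s * r)

theorem measurable_dilateRadii {E : Type*} [MeasurableSpace E] (s : ℝ) :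
    Measurable (dilateRadii s : E × ℝ → E × ℝ) := by
  unfold dilateRadii; fun_prop

theorem voidLaw_map_dilateRadii_mem (d : ℕ) (μ : Measure ℝ) [IsFiniteMeasure μ] (s r : ℝ) :
    voidLaw (boolIntensity d μ) {m | m.map (dilateRadii s) ∈ crossEvent 0 r} =
      crossProb d (μ.map fun r => s * r) r := by
  have e : boolIntensity d (μ.map fun r => s * r) = (boolIntensity d μ).map (dilateRadii s) := by
    rw [dilateRadii, boolIntensity, ← Measure.map_prod_map _ _ measurable_id (by fun_prop),
      Measure.map_id]
  have hs : SigmaFinite ((boolIntensity d μ).map (dilateRadii s)) := by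
    rw [← e]; infer_instance
  rw [crossProb, e, voidLaw_map (measurable_dilateRadii s) (measurableSet_crossEvent 0 r)]

/-- If the balls of `m₁` near `B(0, R)` have radius at least `τ` and the components of the covered
set of `m₂` near `B(0, R)` have diameter less than `δ ≤ s τ`, then the crossings of `m₁ + m₂` are
crossings of the Boolean model obtained from `m₁` by multiplying the radii by `1 + s`. -/
theorem mem_crossEvent_map_dilateRadii {d : ℕ} {m₁ m₂ : Measure (EuclideanSpace ℝ (Fin d) × ℝ)}
    {R s τ δ : ℝ} (hs : 0 < s) (hτR : τ ≤ R / 4) (hδ : 0 < δ) (hδτ : δ ≤ s * τ)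
    (hδR : δ ≤ R / 4) (hsmall : m₁ (Metric.ball 0 (2 * R) ×ˢ Iio τ) = 0)
    (hcomp : ∀ x ∈ Metric.closedBall (0 : EuclideanSpace ℝ (Fin d)) R, ∀ y,
      JoinedIn (coveredSet m₂) x y → dist x y < δ)
    (h : m₁ + m₂ ∈ crossEvent 0 R) : m₁.map (dilateRadii (1 + s)) ∈ crossEvent 0 R := by
  obtain ⟨u, hu, v, hv, hj⟩ := PathConnects.truncate_sphere (by linarith) h
  refine ⟨u, hu, v, hv, ?_⟩
  rw [coveredSet_add] at hj
  rw [mem_sphere_zero_iff_norm] at hu hv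
  refine hj.of_union_of_small hδ (isOpen_coveredSet m₁) (isOpen_coveredSet m₂) hcomp ?_ ?_
  · have := norm_le_norm_add_norm_sub u v
    rw [dist_eq_norm]
    linarith
  · intro x hx y hy hxy h0
    rw [Measure.map_apply (measurable_dilateRadii _) (measurableSet_dist_lt x)] at h0
    refine hy (measure_mono_null ?_ (measure_union_null hsmall h0))
    intro z hz
    simp only [mem_ofPred_eq, mem_closedBall_zero_iff] at hz hx
    -- A ball of radius below `τ` covering `y` would have its center within `R + δ + τ < 2R` of the
    -- origin, which is excluded. Otherwise `δ ≤ s * z.2`, so the enlarged ball reaches `x`.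
    by_cases hzτ : z.2 < τ
    · left
      refine ⟨?_, hzτ⟩
      rw [mem_ball_zero_iff]
      have := dist_triangle4 z.1 y x 0
      rw [dist_zero_right, dist_zero_right, dist_comm z.1 y, dist_comm y x] at this
      linarith
    · right
      simp only [dilateRadii, mem_preimage, mem_ofPred_eq, Prod.map_fst, Prod.map_snd, id]
      have h1 := dist_triangle x y z.1
      have h2 : s * τ ≤ s * z.2 := mul_le_mul_of_nonneg_left (not_lt.1 hzτ) hs.le
      linarith

/-- If `x` is within `δ / 4` of a center `c` and is joined to a point at distance at least `δ`, that
point is at least `3δ / 4` away from `c`, so the path crosses from `S(c, δ / 4)` to `S(c, δ / 2)`.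
Finitely many centers suffice. -/
theorem exists_cover_joinedIn_small {d : ℕ} (R : ℝ) {δ : ℝ} (hδ : 0 < δ) :
    ∃ Y : Finset (EuclideanSpace ℝ (Fin d)), ∀ m : Measure (EuclideanSpace ℝ (Fin d) × ℝ),
      (∀ c ∈ Y, m ∉ crossEvent c (δ / 2)) →
        ∀ x ∈ Metric.closedBall (0 : EuclideanSpace ℝ (Fin d)) R, ∀ y,
          JoinedIn (coveredSet m) x y → dist x y < δ := by
  obtain ⟨Y, -, hYf, hcov⟩ := (isCompact_closedBall (0 : EuclideanSpace ℝ (Fin d))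
    R).finite_cover_balls (show 0 < δ / 4 by linarith)
  refine ⟨hYf.toFinset, fun m hm x hx y hj => ?_⟩
  by_contra! hc
  have h1 := hcov hx
  simp only [mem_iUnion, Metric.mem_ball, exists_prop] at h1
  obtain ⟨c, hcY, hxc⟩ := h1
  refine hm c (hYf.mem_toFinset.2 hcY) (hj.pathConnects_sphere (by linarith) (by linarith) ?_)
  have := dist_triangle_right x y c
  linarith

theorem tendsto_measure_Iio_inv (μ : Measure ℝ) [IsFiniteMeasure μ] (h0 : μ (Iic 0) = 0) :
    Tendsto (fun n : ℕ => μ (Iio (1 / ((n : ℝ) + 1)))) atTop (𝓝 0) := by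
  have h := tendsto_measure_iInter_atTop (μ := μ) (s := fun n : ℕ => Iio (1 / ((n : ℝ) + 1)))
    (fun n => measurableSet_Iio.nullMeasurableSet)
    (fun m n h => Iio_subset_Iio (one_div_le_one_div_of_le (by positivity) (by gcongr)))
    ⟨0, measure_ne_top _ _⟩
  have e : ⋂ n : ℕ, Iio (1 / ((n : ℝ) + 1)) ⊆ Iic 0 := by
    intro x hx
    by_contra! hc
    obtain ⟨n, hn⟩ := exists_nat_one_div_lt (show 0 < x from not_le.1 hc)
    exact absurd (mem_iInter.1 hx n) (not_lt.2 hn.le)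
  rwa [measure_mono_null e h0] at h

/-- The order of choices matters: `R` from the dilated first model and the moment tails, `τ` from
`R`, `δ` from `s`, `τ` and `R`, and only at the end `ρ`. The crossing probability at scale `R`
splits into three events of probability at most `η / 3`: a crossing of the dilated model, a ball of
`μ₁` with radius below `τ`, a component of the shrunken model that is not small. -/
theorem crossingVanishes_add_scaleMeasure {d : ℕ} (hd : 0 < d) {μ₁ μ₂ : Measure ℝ}
    [IsFiniteMeasure μ₁] [IsFiniteMeasure μ₂] (h0 : μ₁ (Iic 0) = 0) {s : ℝ} (hs : 0 < s)
    (h1 : CrossingVanishes d (μ₁.map fun r => (1 + s) * r)) (h2 : CrossingVanishes d μ₂) :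
    ∀ᶠ ρ in atTop, CrossingVanishes d (μ₁ + scaleMeasure d ρ μ₂) := by
  obtain ⟨η, hη, hcrit⟩ := exists_finite_size_criterion hd
  have hη3 : 0 < η / 3 := ENNReal.div_pos hη.ne' (by norm_num)
  have hη2 : 0 < η / 2 := ENNReal.half_pos hη.ne'
  -- Subcriticality is assumed only for the dilated radii, whose moment dominates since radii are
  -- almost everywhere positive.
  have hmom₁ : ∫⁻ r, ENNReal.ofReal r ^ d ∂μ₁ ≠ ∞ := by
    have := h1.lintegral_ne_top hd
    rw [lintegral_map (by fun_prop) (by fun_prop)] at this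
    refine ne_top_of_le_ne_top this (lintegral_mono_ae ?_)
    have hae : ∀ᵐ r ∂μ₁, r ∉ Iic (0 : ℝ) := measure_eq_zero_iff_ae_notMem.1 h0
    filter_upwards [hae] with r hr
    refine pow_le_pow_left' (ENNReal.ofReal_le_ofReal ?_) d
    have : 0 < r := not_le.1 hr
    nlinarith
  have ht₁ := tendsto_momentTail hmom₁
  have ht₂ := tendsto_momentTail (h2.lintegral_ne_top hd)
  rw [crossingVanishes_iff] at h1 h2
  obtain ⟨R, hR, hcross, htail₁, htail₂⟩ : ∃ R : ℝ, 0 < R ∧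
      crossProb d (μ₁.map fun r => (1 + s) * r) R ≤ η / 3 ∧ momentTail d μ₁ R ≤ η / 2 ∧
      momentTail d μ₂ R ≤ η / 2 :=
    ((eventually_gt_atTop 0).and ((ENNReal.tendsto_nhds_zero.1 h1 _ hη3).and
      ((ENNReal.tendsto_nhds_zero.1 ht₁ _ hη2).and
        (ENNReal.tendsto_nhds_zero.1 ht₂ _ hη2)))).exists
  obtain ⟨τ, hτ, hτR, hτs⟩ : ∃ τ : ℝ, 0 < τ ∧ τ ≤ R / 4 ∧
      boolIntensity d μ₁ (Metric.ball 0 (2 * R) ×ˢ Iio τ) ≤ η / 3 := by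
    have ht := ENNReal.Tendsto.const_mul
      (a := volume (Metric.ball (0 : EuclideanSpace ℝ (Fin d)) (2 * R)))
      (tendsto_measure_Iio_inv μ₁ h0) (Or.inr measure_ball_lt_top.ne)
    rw [mul_zero] at ht
    obtain ⟨n, hn, hn'⟩ := ((ENNReal.tendsto_nhds_zero.1 ht _ hη3).and
      ((tendsto_one_div_add_atTop_nhds_zero_nat (𝕜 := ℝ)).eventually
        (ge_mem_nhds (show 0 < R / 4 by linarith)))).exists
    refine ⟨1 / ((n : ℝ) + 1), by positivity, hn', ?_⟩
    rw [boolIntensity, Measure.prod_prod]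
    exact hn
  set δ := min (s * τ) (R / 4) with hδdef
  have hδ : 0 < δ := lt_min (by positivity) (by positivity)
  obtain ⟨Y, hY⟩ := exists_cover_joinedIn_small (d := d) R hδ
  have hρlim : Tendsto (fun ρ : ℝ => (Y.card : ℝ≥0∞) * crossProb d μ₂ (ρ * (δ / 2)))
      atTop (𝓝 0) := by
    have h3 : Tendsto (fun ρ : ℝ => ρ * (δ / 2)) atTop atTop :=
      tendsto_id.atTop_mul_const (by positivity)
    have := ENNReal.Tendsto.const_mul (a := (Y.card : ℝ≥0∞)) (h2.comp h3)
      (Or.inr (ENNReal.natCast_ne_top _))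
    simpa using this
  filter_upwards [ENNReal.tendsto_nhds_zero.1 hρlim _ hη3, eventually_ge_atTop 1] with ρ hρ hρ1
  have hρ0 : 0 < ρ := by linarith
  have htail : ∀ r, 0 ≤ r → momentTail d (μ₁ + scaleMeasure d ρ μ₂) r ≤
      momentTail d μ₁ r + momentTail d μ₂ r := by
    intro r hr
    rw [momentTail_add, momentTail_scaleMeasure d hρ0]
    gcongr
    exact momentTail_antitone d μ₂ (by nlinarith)
  refine hcrit _ inferInstance R hR ?_ ?_ ?_
  · have h4 : Tendsto (fun r => momentTail d μ₁ r + momentTail d μ₂ r) atTop (𝓝 0) := by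
      simpa using ht₁.add ht₂
    exact tendsto_of_tendsto_of_tendsto_of_le_of_le' tendsto_const_nhds h4
      (Eventually.of_forall fun _ => zero_le) ((eventually_ge_atTop 0).mono htail)
  · exact (htail R hR.le).trans ((add_le_add htail₁ htail₂).trans (ENNReal.add_halves η).le)
  · have hQ₁ := isVoidLaw_voidLaw (boolIntensity d μ₁)
    calc localCrossProb d (μ₁ + scaleMeasure d ρ μ₂) R
        ≤ crossProb d (μ₁ + scaleMeasure d ρ μ₂) R :=
          measure_mono (localCrossEvent_subset _ _)
      _ ≤ voidLaw (boolIntensity d μ₁) ({m | m (Metric.ball 0 (2 * R) ×ˢ Iio τ) ≠ 0} ∪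
            {m | m.map (dilateRadii (1 + s)) ∈ crossEvent 0 R}) +
          voidLaw (boolIntensity d (scaleMeasure d ρ μ₂)) (⋃ c ∈ Y, crossEvent c (δ / 2)) := by
        rw [crossProb, boolIntensity, boolIntensity, boolIntensity, Measure.prod_add]
        refine voidLaw_add_le (measurableSet_crossEvent 0 R) fun m₁ m₂ hm => ?_
        by_cases hc : ∀ c ∈ Y, m₂ ∉ crossEvent c (δ / 2)
        · left
          by_cases hsm : m₁ (Metric.ball 0 (2 * R) ×ˢ Iio τ) = 0
          · exact Or.inr (mem_crossEvent_map_dilateRadii hs hτR hδ (min_le_left _ _)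
              (min_le_right _ _) hsm (hY m₂ hc) hm)
          · exact Or.inl hsm
        · right
          push Not at hc
          simpa only [mem_iUnion, exists_prop] using hc
      _ ≤ (η / 3 + η / 3) + η / 3 := by
        refine add_le_add ((measure_union_le _ _).trans (add_le_add ?_ ?_)) ?_
        · exact (hQ₁.measure_ne_zero_le
            (Metric.isOpen_ball.measurableSet.prod measurableSet_Iio)).trans hτs
        · rw [voidLaw_map_dilateRadii_mem]
          exact hcross
        · refine (measure_biUnion_finset_le _ _).trans (le_trans ?_ hρ)
          refine (Finset.sum_le_card_nsmul Y _ (crossProb d μ₂ (ρ * (δ / 2)))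
            fun c _ => ?_).trans (le_of_eq (nsmul_eq_mul _ _))
          rw [voidLaw_crossEvent, crossProb_scaleMeasure d hρ0]
      _ = η := ENNReal.add_thirds η

/-- Enlarging the radii alone is a dilation of space combined with a denser set of centers; by scale
invariance, only the factor `s ^ d` on the intensity matters for criticality. -/
theorem map_const_mul_eq_scaleMeasure (d : ℕ) {s : ℝ} (hs : 0 < s) (μ : Measure ℝ) :
    μ.map (fun r => s * r) = scaleMeasure d s⁻¹ (ENNReal.ofReal (s ^ d) • μ) := by
  rw [scaleMeasure_smul, scaleMeasure, smul_smul, ENNReal.ofReal_pow hs.le, ← mul_pow,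
    ← ENNReal.ofReal_mul hs.le, mul_inv_cancel₀ hs.ne', ENNReal.ofReal_one, one_pow, one_smul]
  congr 1
  ext r
  rw [div_inv_eq_mul, mul_comm]

theorem crossingVanishes_mixture {d : ℕ} (hd : 0 < d) {ν₁ ν₂ : Measure ℝ}
    [IsFiniteMeasure ν₁] [IsFiniteMeasure ν₂] (h0 : ν₁ (Iic 0) = 0) {a b : ℝ≥0}
    (ha : (a : ℝ≥0∞) < lambdaHat d ν₁) (hb : (b : ℝ≥0∞) < lambdaHat d ν₂) :
    ∀ᶠ ρ in atTop, CrossingVanishes d (a • ν₁ + b • scaleMeasure d ρ ν₂) := by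
  obtain ⟨s, hs, hsa⟩ : ∃ s : ℝ, 0 < s ∧
      ENNReal.ofReal ((1 + s) ^ d) * a < lambdaHat d ν₁ := by
    have hc : Tendsto (fun s : ℝ => ENNReal.ofReal ((1 + s) ^ d) * a) (𝓝[>] 0) (𝓝 a) := by
      have h1 : Continuous fun s : ℝ => ENNReal.ofReal ((1 + s) ^ d) :=
        ENNReal.continuous_ofReal.comp (by fun_prop)
      have h2 := (h1.tendsto 0).mono_left (nhdsWithin_le_nhds (s := Ioi 0))
      have h3 := ENNReal.Tendsto.mul_const (b := (a : ℝ≥0∞)) h2 (Or.inr ENNReal.coe_ne_top)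
      simpa using h3
    obtain ⟨s, h1, h2⟩ := ((hc.eventually (gt_mem_nhds ha)).and self_mem_nhdsWithin).exists
    exact ⟨s, h2, h1⟩
  have h1 : CrossingVanishes d ((a • ν₁).map fun r => (1 + s) * r) := by
    rw [map_const_mul_eq_scaleMeasure d (by linarith), crossingVanishes_scaleMeasure d (by positivity)]
    have e : ENNReal.ofReal ((1 + s) ^ d) • a • ν₁ = (((1 + s) ^ d).toNNReal * a) • ν₁ := by
      rw [mul_smul]; rfl
    rw [e]
    refine crossingVanishes_of_lt_lambdaHat ?_
    rw [ENNReal.coe_mul]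
    exact hsa
  have h00 : (a • ν₁) (Iic 0) = 0 := by simp [h0]
  have := crossingVanishes_add_scaleMeasure hd h00 hs h1 (crossingVanishes_of_lt_lambdaHat hb)
  simpa only [scaleMeasure_nnreal_smul] using this

end Mixture

/-! ### The main theorem and uniformity in `α` -/

section MainTheorem

theorem lambdaHat_mixMeasure_le (d : ℕ) (α ρ : ℝ) (ν₁ ν₂ : Measure ℝ) [IsFiniteMeasure ν₁]
    [IsFiniteMeasure ν₂] : lambdaHat d (mixMeasure d α ρ ν₁ ν₂) ≤
      min (lambdaHat d (ENNReal.ofReal α • ν₁))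
        (lambdaHat d (ENNReal.ofReal (1 - α) • scaleMeasure d ρ ν₂)) := by
  refine le_min (lambdaHat_add_le _ _ _) ?_
  rw [mixMeasure, add_comm]
  exact lambdaHat_add_le _ _ _

theorem min_lambdaHat_eq (d : ℕ) {α ρ : ℝ} (hα : α ∈ Ioo (0 : ℝ) 1) (hρ : 0 < ρ)
    (ν₁ ν₂ : Measure ℝ) [IsFiniteMeasure ν₂] :
    min (lambdaHat d (ENNReal.ofReal α • ν₁))
        (lambdaHat d (ENNReal.ofReal (1 - α) • scaleMeasure d ρ ν₂)) =
      min (lambdaHat d ν₁ / ENNReal.ofReal α) (lambdaHat d ν₂ / ENNReal.ofReal (1 - α)) := by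
  rw [lambdaHat_ofReal_smul d hα.1, lambdaHat_ofReal_smul d (sub_pos.2 hα.2),
    lambdaHat_scaleMeasure d hρ]

/-- One subcritical pair `(a, b)` dominates the mixtures for all `α` at once, which is the source of
the uniformity: the threshold value of `ρ` does not depend on `α`. -/
theorem le_lambdaHat_mixMeasure {d : ℕ} {ν₁ ν₂ : Measure ℝ} [IsFiniteMeasure ν₁]
    [IsFiniteMeasure ν₂] {a b : ℝ≥0} {ρ : ℝ}
    (h : CrossingVanishes d (a • ν₁ + b • scaleMeasure d ρ ν₂)) {α l : ℝ} (hα : α ∈ Ioo (0 : ℝ) 1)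
    (ha : l * α ≤ a) (hb : l * (1 - α) ≤ b) :
    ENNReal.ofReal l ≤ lambdaHat d (mixMeasure d α ρ ν₁ ν₂) := by
  refine le_lambdaHat (l := l.toNNReal) ?_
  rw [mixMeasure, smul_add, nnreal_smul_ofReal_smul, nnreal_smul_ofReal_smul]
  have ha' : l.toNNReal * α.toNNReal ≤ a := by
    rw [mul_comm, ← Real.toNNReal_mul hα.1.le, mul_comm]
    exact Real.toNNReal_le_iff_le_coe.2 ha
  have hb' : l.toNNReal * (1 - α).toNNReal ≤ b := by
    rw [mul_comm, ← Real.toNNReal_mul (sub_nonneg.2 hα.2.le), mul_comm]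
    exact Real.toNNReal_le_iff_le_coe.2 hb
  rw [← add_tsub_cancel_of_le ha', ← add_tsub_cancel_of_le hb', add_smul, add_smul,
    add_add_add_comm] at h
  exact h.of_add

/-- With `m` the minimum, `α m ≤ x` and `(1 - α) m ≤ y` add up to `m ≤ x + y`. The limit is thus
bounded uniformly in `α`, so a relative error becomes a uniform absolute one. -/
theorem min_div_le_add {x y α : ℝ} (hα : α ∈ Ioo (0 : ℝ) 1) :
    min (x / α) (y / (1 - α)) ≤ x + y := by
  by_contra! hc
  obtain ⟨h1, h2⟩ := lt_min_iff.1 hc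
  rw [lt_div_iff₀ hα.1] at h1
  rw [lt_div_iff₀ (sub_pos.2 hα.2)] at h2
  linarith

theorem proposition1 (d : ℕ) (hd : 2 ≤ d) (ν₁ ν₂ : Measure ℝ)
    [IsFiniteMeasure ν₁] [IsFiniteMeasure ν₂]
    (hν₁ : ν₁ (Iic 0) = 0) (hν₂ : ν₂ (Iic 0) = 0) (hpos₁ : ν₁ ≠ 0) (hpos₂ : ν₂ ≠ 0) :
    (lambdaHat d ν₁ ≠ ∞ ∧ lambdaHat d ν₂ ≠ ∞) ∧
    (∀ α ∈ Ioo (0 : ℝ) 1, ∀ ρ : ℝ, 1 < ρ →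
      lambdaHat d (mixMeasure d α ρ ν₁ ν₂) ≤
        min (lambdaHat d (ENNReal.ofReal α • ν₁))
          (lambdaHat d (ENNReal.ofReal (1 - α) • scaleMeasure d ρ ν₂)) ∧
      min (lambdaHat d (ENNReal.ofReal α • ν₁))
          (lambdaHat d (ENNReal.ofReal (1 - α) • scaleMeasure d ρ ν₂)) =
        min (lambdaHat d ν₁ / ENNReal.ofReal α) (lambdaHat d ν₂ / ENNReal.ofReal (1 - α))) ∧
    TendstoUniformlyOn
      (fun (ρ : ℝ) (α : ℝ) => (lambdaHat d (mixMeasure d α ρ ν₁ ν₂)).toReal)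
      (fun α : ℝ =>
        (min (lambdaHat d ν₁ / ENNReal.ofReal α) (lambdaHat d ν₂ / ENNReal.ofReal (1 - α))).toReal)
      atTop (Ioo (0 : ℝ) 1) := by
  have ht₁ := lambdaHat_ne_top d hd ν₁ hν₁ hpos₁
  have ht₂ := lambdaHat_ne_top d hd ν₂ hν₂ hpos₂
  refine ⟨⟨ht₁, ht₂⟩, fun α hα ρ hρ => ⟨lambdaHat_mixMeasure_le d α ρ ν₁ ν₂,
    min_lambdaHat_eq d hα (by linarith) ν₁ ν₂⟩, ?_⟩
  set x := (lambdaHat d ν₁).toReal with hx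
  set y := (lambdaHat d ν₂).toReal with hy
  have hx0 : 0 ≤ x := ENNReal.toReal_nonneg
  have hy0 : 0 ≤ y := ENNReal.toReal_nonneg
  have hx' : lambdaHat d ν₁ = ENNReal.ofReal x := (ENNReal.ofReal_toReal ht₁).symm
  have hy' : lambdaHat d ν₂ = ENNReal.ofReal y := (ENNReal.ofReal_toReal ht₂).symm
  have hmin : ∀ α ∈ Ioo (0 : ℝ) 1,
      min (lambdaHat d ν₁ / ENNReal.ofReal α) (lambdaHat d ν₂ / ENNReal.ofReal (1 - α)) =
        ENNReal.ofReal (min (x / α) (y / (1 - α))) := by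
    intro α hα
    rw [hx', hy', ← ENNReal.ofReal_div_of_pos hα.1, ← ENNReal.ofReal_div_of_pos (sub_pos.2 hα.2),
      ENNReal.ofReal_min]
  have hm0 : ∀ α ∈ Ioo (0 : ℝ) 1, 0 ≤ min (x / α) (y / (1 - α)) := fun α hα =>
    le_min (div_nonneg hx0 hα.1.le) (div_nonneg hy0 (sub_pos.2 hα.2).le)
  have hupper : ∀ ρ : ℝ, 0 < ρ → ∀ α ∈ Ioo (0 : ℝ) 1,
      lambdaHat d (mixMeasure d α ρ ν₁ ν₂) ≤ ENNReal.ofReal (min (x / α) (y / (1 - α))) := by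
    intro ρ hρ α hα
    rw [← hmin α hα, ← min_lambdaHat_eq d hα hρ ν₁ ν₂]
    exact lambdaHat_mixMeasure_le d α ρ ν₁ ν₂
  rw [Metric.tendstoUniformlyOn_iff]
  intro ε hε
  suffices hlow : ∀ᶠ ρ in atTop, ∀ α ∈ Ioo (0 : ℝ) 1,
      ENNReal.ofReal (min (x / α) (y / (1 - α)) - ε / 2) ≤
        lambdaHat d (mixMeasure d α ρ ν₁ ν₂) by
    filter_upwards [hlow, eventually_gt_atTop 0] with ρ hρ hρ0 α hα
    have h1 := ENNReal.toReal_mono (ne_top_of_le_ne_top ENNReal.ofReal_ne_top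
      (hupper ρ hρ0 α hα)) (hρ α hα)
    have h2 := ENNReal.toReal_mono ENNReal.ofReal_ne_top (hupper ρ hρ0 α hα)
    rw [ENNReal.toReal_ofReal (hm0 α hα)] at h2
    have h3 : min (x / α) (y / (1 - α)) - ε / 2 ≤
        (lambdaHat d (mixMeasure d α ρ ν₁ ν₂)).toReal := by
      refine le_trans ?_ h1
      rw [ENNReal.toReal_ofReal']
      exact le_max_left _ _
    rw [hmin α hα, ENNReal.toReal_ofReal (hm0 α hα), Real.dist_eq, abs_lt]
    constructor <;> linarith
  by_cases hpos : 0 < x ∧ 0 < y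
  · obtain ⟨hxp, hyp⟩ := hpos
    -- The pair `((1 - t) x, (1 - t) y)` lies strictly below both thresholds; the resulting loss,
    -- `t` times the minimum, is at most `t (x + y) ≤ ε / 2`.
    obtain ⟨t, ht0, ht1⟩ := exists_between
      (show (0 : ℝ) < min 1 (ε / 2 / (x + y)) from lt_min one_pos (by positivity))
    have ht1' : t < 1 := ht1.trans_le (min_le_left _ _)
    have htε : t * (x + y) ≤ ε / 2 := by
      have := ht1.le.trans (min_le_right _ _)
      rwa [le_div_iff₀ (by positivity)] at this
    have hlt : ∀ w : ℝ, 0 < w → (1 - t) * w < w := fun w hw => by nlinarith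
    have ha : (((1 - t) * x).toNNReal : ℝ≥0∞) < lambdaHat d ν₁ := by
      rw [hx']
      exact (ENNReal.ofReal_lt_ofReal_iff hxp).2 (hlt x hxp)
    have hb : (((1 - t) * y).toNNReal : ℝ≥0∞) < lambdaHat d ν₂ := by
      rw [hy']
      exact (ENNReal.ofReal_lt_ofReal_iff hyp).2 (hlt y hyp)
    filter_upwards [crossingVanishes_mixture (by omega) hν₁ ha hb] with ρ hρ α hα
    have hα1 : 0 < 1 - α := sub_pos.2 hα.2
    refine le_trans (ENNReal.ofReal_le_ofReal ?_) (le_lambdaHat_mixMeasure hρ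
      (l := (1 - t) * min (x / α) (y / (1 - α))) hα ?_ ?_)
    · have := min_div_le_add (x := x) (y := y) hα
      nlinarith
    · rw [Real.coe_toNNReal _ (mul_nonneg (by linarith) hx0), mul_assoc]
      refine mul_le_mul_of_nonneg_left ?_ (by linarith)
      calc _ ≤ x / α * α := mul_le_mul_of_nonneg_right (min_le_left _ _) hα.1.le
        _ = x := div_mul_cancel₀ _ hα.1.ne'
    · rw [Real.coe_toNNReal _ (mul_nonneg (by linarith) hy0), mul_assoc]
      refine mul_le_mul_of_nonneg_left ?_ (by linarith)
      calc _ ≤ y / (1 - α) * (1 - α) := mul_le_mul_of_nonneg_right (min_le_right _ _) hα1.le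
        _ = y := div_mul_cancel₀ _ hα1.ne'
  -- If one of the thresholds vanishes, the limit is `0` and the lower bound is trivial.
  · refine Eventually.of_forall fun ρ α hα => ?_
    have : min (x / α) (y / (1 - α)) ≤ 0 := by
      by_contra! hc
      obtain ⟨h1, h2⟩ := lt_min_iff.1 hc
      exact hpos ⟨(div_pos_iff_of_pos_right hα.1).1 h1,
        (div_pos_iff_of_pos_right (sub_pos.2 hα.2)).1 h2⟩
    rw [ENNReal.ofReal_of_nonpos (by linarith)]
    exact zero_le

end MainTheorem
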